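/- Let $n>2k\ge 10$ be integers and $[n]=\{1,\dots,n\}$. Call a family of sets intersecting if any two of its members have a common element. For $i\in\{1,3\}$ put $I_i=\{i+1,\dots,i+k\}$, and let $$\mathcal J_3=\{I_1,I_3\}\cup\Big\{F\in\binom{[n]}{k}: 1\in F,\ F\cap I_1\ne\emptyset,\ F\cap I_3\ne\emptyset\Big\}.$$ For $x\in[n]$ and a family $\mathcal G$ write $\mathcal G(\bar x)=\{G\in\mathcal G: x\notin G\}$. For $0\le l\le n-k$ let $\mathcal E_l$ denote the (unique up to a permutation of $[n]$) family $\mathcal E\subset\binom{[n]}{k}$ that, for some $x\in[n]$, is inclusion-maximal among the intersecting families $\mathcal G\subset\binom{[n]}{k}$ with $|\mathcal G(\bar x)|=l$ and, if $l\ge 2$, $\big|\bigcap_{G\in\mathcal G(\bar x)}G\big|=k-1$. (Thus $\mathcal E_0$ is a full star, and $\mathcal E_1$ is a Hilton--Milner family.) If $\mathcal F\subset\binom{[n]}{k}$ is an intersecting family with $|\mathcal F|>|\mathcal J_3|$, then there is $l\in\{0,1,\dots,k-1,n-k\}$ such that $\mathcal F$ is contained in a family isomorphic to $\mathcal E_l$,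 that is, in an image of $\mathcal E_l$ under a permutation of $[n]$. -/

import Mathlib

namespace LargeIntersecting

/-- The ground set `[n] = {1, …, n}`. -/
def ground (n : ℕ) : Finset ℕ := Finset.Icc 1 n

/-- `F` is an intersecting family of `k`-element subsets of `[n]`. -/
def IsIntersectingFamily (n k : ℕ) (F : Finset (Finset ℕ)) : Prop :=
  F ⊆ (ground n).powersetCard k ∧ ∀ A ∈ F, ∀ B ∈ F, (A ∩ B).Nonempty

/-- `I_i = [i + 1, k + i]`. -/
def interval (k i : ℕ) : Finset ℕ := Finset.Icc (i + 1) (k + i)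

/-- `J_i`: the two sets `I_1`, `I_i`, together with all `k`-subsets of `[n]` that contain `1`
and meet both `I_1` and `I_i`. -/
def familyJ (n k i : ℕ) : Finset (Finset ℕ) :=
  {interval k 1, interval k i} ∪
    ((ground n).powersetCard k).filter fun F =>
      1 ∈ F ∧ (F ∩ interval k 1).Nonempty ∧ (F ∩ interval k i).Nonempty

/-- The members of `F` that do not contain `x`. -/
def avoiding (x : ℕ) (F : Finset (Finset ℕ)) : Finset (Finset ℕ) :=
  F.filter fun A => x ∉ A

/-- The elements of `[n]` that lie in every member of `M`. -/
def commonIntersection (n : ℕ) (M : Finset (Finset ℕ)) : Finset ℕ :=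
  (ground n).filter fun j => ∀ A ∈ M, j ∈ A

/-- `E` is a copy of `E_l` in which `x` plays the role of the element `1`: it is inclusion-maximal
among the intersecting families of `k`-subsets of `[n]` with exactly `l` members avoiding `x`,
these members having common intersection of size `k - 1`.  For `l ≤ 1` there are no two members
avoiding `x` and the condition on their intersection is void, so that `E_0` is a full star and
`E_1` is a Hilton–Milner family. -/
def IsCopyOfE (n k l x : ℕ) (E : Finset (Finset ℕ)) : Prop :=
  Maximal (fun G : Finset (Finset ℕ) =>
    IsIntersectingFamily n k G ∧ (avoiding x G).card = l ∧
      (2 ≤ l → (commonIntersection n (avoiding x G)).card = k - 1)) E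

end LargeIntersecting

/-! Fix a point `x` and let `ℬ` be the members of `F` avoiding `x`, and `𝒳` the `(k-1)`-sets whose
extension by `x` is not in `F`. Then `#F = (n-1).choose (k-1) + #ℬ - #𝒳`, and `𝒳` contains every
`(k-1)`-set disjoint from a member of `ℬ`. So it suffices to bound `#ℬ - #𝒳` from above, by its
value for `familyJ n k 3`, whenever no `x` gives an `ℬ` with `k - 1` common elements. A structured
`F`, one that has such an `x`, embeds directly in a copy of some `E_l`. The difference is bounded by
branching: for each element `i`, count members of `ℬ` with or without `i` against members of `𝒳`
without or with `i`. Most leaves are nonpositive by double counting (`excess_nonpos`) or by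
Kruskal–Katona (`excess_nonpos_of_card_le`); the few others, where `W` contains a member of `ℬ`,
supply the binomials. With `m = n - 1 - k`: if `#ℬ ≤ 2 * m`, the tree follows either two members
with at most `k - 2` common elements or three `k`-subsets of a `(k+1)`-set; if `#ℬ` is larger but at
most `(n-3).choose (k-2)`, it runs on the colex-extremal family. If `#ℬ` exceeds that threshold for
every point, `F` is shifted, by induction on its weight. A shifted unstructured family contains an
explicit triangle. If a shift from `j` to `i` makes the family structured, few members of `F` avoid
both `i` and `j`, and a cross-intersecting bound for the two links finishes
(`card_le_of_two_points`). -/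

namespace LargeIntersecting

open Finset

/-! ### Branching on elements and the excess. -/

section Slices

variable {α : Type*} [DecidableEq α]

/-- The members of `𝒢` that contain `U` and are disjoint from `W`. -/
def slice (U W : Finset α) (𝒢 : Finset (Finset α)) : Finset (Finset α) :=
  𝒢.filter fun A => U ⊆ A ∧ Disjoint A W

theorem mem_slice {U W A : Finset α} {𝒢 : Finset (Finset α)} :
    A ∈ slice U W 𝒢 ↔ A ∈ 𝒢 ∧ U ⊆ A ∧ Disjoint A W := by
  simp [slice]

theorem slice_empty_empty (𝒢 : Finset (Finset α)) : slice ∅ ∅ 𝒢 = 𝒢 := by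
  simp [slice]

theorem card_slice_eq_add (U W : Finset α) (𝒢 : Finset (Finset α)) (i : α) :
    #(slice U W 𝒢) = #(slice (insert i U) W 𝒢) + #(slice U (insert i W) 𝒢) := by
  rw [← card_filter_add_card_filter_not (s := slice U W 𝒢) (fun A => i ∈ A)]
  congr 2
  · ext A
    simp only [mem_filter, mem_slice, insert_subset_iff]
    tauto
  · ext A
    simp only [mem_filter, mem_slice, disjoint_insert_right]
    tauto

theorem card_slice_powersetCard {U W V : Finset α} {p : ℕ} (hU : U ⊆ V) (hW : W ⊆ V)
    (hUW : Disjoint U W) (hp : #U ≤ p) :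
    #(slice U W (V.powersetCard p)) = (#V - #U - #W).choose (p - #U) := by
  have h : slice U W (V.powersetCard p) =
      ((V \ (U ∪ W)).powersetCard (p - #U)).image (U ∪ ·) := by
    ext X
    simp only [mem_slice, mem_image, mem_powersetCard]
    constructor
    · rintro ⟨⟨hXV, hX⟩, hUX, hXW⟩
      refine ⟨X \ U, ⟨?_, ?_⟩, union_sdiff_of_subset hUX⟩
      · intro a ha
        rw [mem_sdiff] at ha
        have := disjoint_left.1 hXW ha.1
        simp [hXV ha.1, ha.2, this]
      · rw [card_sdiff_of_subset hUX, hX]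
    · rintro ⟨Y, ⟨hY, hYc⟩, rfl⟩
      have hd : Disjoint U Y := disjoint_left.2 fun a ha hb => by
        have := hY hb
        simp [ha] at this
      refine ⟨⟨union_subset hU fun a ha => (mem_sdiff.1 (hY ha)).1, ?_⟩,
        subset_union_left, ?_⟩
      · rw [card_union_of_disjoint hd, hYc]; omega
      · rw [disjoint_union_left]
        refine ⟨hUW, disjoint_left.2 fun a ha hb => ?_⟩
        have := hY ha
        simp [hb] at this
  rw [h, card_image_of_injOn, card_powersetCard, card_sdiff_of_subset (union_subset hU hW),
    card_union_of_disjoint hUW, Nat.sub_sub]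
  intro Y hY Z hZ hYZ
  simp only [mem_coe, mem_powersetCard] at hY hZ
  have key : ∀ Y : Finset α, Y ⊆ V \ (U ∪ W) → (U ∪ Y) \ U = Y := by
    intro Y hY
    rw [union_sdiff_left, Finset.sdiff_eq_self_iff_disjoint]
    exact disjoint_left.2 fun a ha hb => by
      have := hY ha
      simp [hb] at this
  rw [← key Y hY.1, ← key Z hZ.1]
  simp only at hYZ
  rw [hYZ]

/-- `𝒳` contains all `p`-subsets of `V` that are disjoint from some member of `ℬ`. -/
def Blocks (V : Finset α) (p : ℕ) (ℬ 𝒳 : Finset (Finset α)) : Prop :=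
  ∀ X ∈ V.powersetCard p, ∀ B ∈ ℬ, Disjoint X B → X ∈ 𝒳

/-- The number of members of `ℬ` containing `W` and avoiding `U`, minus the number of members of
`𝒳` containing `U` and avoiding `W`. -/
def excess (ℬ 𝒳 : Finset (Finset α)) (U W : Finset α) : ℤ :=
  (#(slice W U ℬ) : ℤ) - #(slice U W 𝒳)

theorem excess_empty (ℬ 𝒳 : Finset (Finset α)) : excess ℬ 𝒳 ∅ ∅ = (#ℬ : ℤ) - #𝒳 := by
  simp [excess, slice_empty_empty]

theorem excess_eq_add (ℬ 𝒳 : Finset (Finset α)) (U W : Finset α) (i : α) :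
    excess ℬ 𝒳 U W = excess ℬ 𝒳 (insert i U) W + excess ℬ 𝒳 U (insert i W) := by
  unfold excess
  rw [card_slice_eq_add W U ℬ i, card_slice_eq_add U W 𝒳 i]
  push_cast
  ring

/-- Branch on the elements of `T` in turn: every branch that puts one into `U` is nonpositive and
can be dropped, so only the branch with all of `T` in `W` survives. -/
theorem excess_le_excess_union {ℬ 𝒳 : Finset (Finset α)} {U W : Finset α} (T : Finset α)
    (h : ∀ i ∈ T, ∀ W', W ⊆ W' → W' ⊆ W ∪ T → i ∉ W' → excess ℬ 𝒳 (insert i U) W' ≤ 0) :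
    excess ℬ 𝒳 U W ≤ excess ℬ 𝒳 U (W ∪ T) := by
  induction T using Finset.induction_on with
  | empty => simp
  | insert i T hi ih =>
    have h1 : excess ℬ 𝒳 U W ≤ excess ℬ 𝒳 U (W ∪ T) := ih fun j hj W' hW hW' hjW =>
      h j (mem_insert_of_mem hj) W' hW
        (hW'.trans (union_subset_union_right (subset_insert i T))) hjW
    by_cases hiW : i ∈ W
    · have : W ∪ insert i T = W ∪ T := by
        rw [union_insert, insert_eq_of_mem (mem_union_left _ hiW)]
      rwa [this]
    · have h2 := h i (mem_insert_self i T) (W ∪ T) subset_union_left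
        (union_subset_union_right (subset_insert i T)) (by simp [hi, hiW])
      rw [excess_eq_add ℬ 𝒳 U (W ∪ T) i] at h1
      rw [union_insert]
      linarith

theorem excess_le_of_slice_subset {ℬ 𝒳 : Finset (Finset α)} {U W V : Finset α} {p b : ℕ}
    (hU : U ⊆ V) (hW : W ⊆ V) (hUW : Disjoint U W) (hp : #U ≤ p)
    (h𝒳 : ∀ X ∈ V.powersetCard p, U ⊆ X → Disjoint X W → X ∈ 𝒳) (hb : #(slice W U ℬ) ≤ b) :
    excess ℬ 𝒳 U W ≤ b - ((#V - #U - #W).choose (p - #U) : ℕ) := by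
  have h : (#V - #U - #W).choose (p - #U) ≤ #(slice U W 𝒳) := by
    rw [← card_slice_powersetCard hU hW hUW hp]
    refine card_le_card fun X hX => ?_
    rw [mem_slice] at hX ⊢
    exact ⟨h𝒳 X hX.1 hX.2.1 hX.2.2, hX.2⟩
  unfold excess
  have h1 : (#(slice W U ℬ) : ℤ) ≤ b := by exact_mod_cast hb
  have h2 : (((#V - #U - #W).choose (p - #U) : ℕ) : ℤ) ≤ #(slice U W 𝒳) := by exact_mod_cast h
  linarith

theorem excess_nonpos_of_slice_eq_empty {ℬ 𝒳 : Finset (Finset α)} {U W : Finset α}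
    (h : ∀ B ∈ ℬ, W ⊆ B → ¬ Disjoint B U) : excess ℬ 𝒳 U W ≤ 0 := by
  have : slice W U ℬ = ∅ := by
    ext B
    simp only [mem_slice, notMem_empty, iff_false]
    exact fun hB => h B hB.1 hB.2.1 hB.2.2
  simp [excess, this]

/-- The double counting bound for the disjointness relation between sets containing `U` and
sets containing `W`. -/
theorem excess_nonpos {V : Finset α} {p q : ℕ} {ℬ 𝒳 : Finset (Finset α)} {U W : Finset α}
    (hℬ : ℬ ⊆ V.powersetCard q) (h𝒳 : Blocks V p ℬ 𝒳) (hU : U ⊆ V) (hW : W ⊆ V)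
    (hpq : p + q ≤ #V) (h : q + #U ≤ p + #W) : excess ℬ 𝒳 U W ≤ 0 := by
  by_cases hWq : q < #W
  · refine excess_nonpos_of_slice_eq_empty fun B hB hWB => ?_
    have := (mem_powersetCard.1 (hℬ hB)).2
    have := card_le_card hWB
    omega
  by_cases hUW : Disjoint U W
  swap
  · exact excess_nonpos_of_slice_eq_empty fun B _ hWB hBU =>
      hUW ((disjoint_of_subset_left hWB hBU).symm)
  have hsub : slice U W (𝒳 ∩ V.powersetCard p) ⊆ slice U W 𝒳 := by
    intro X hX
    rw [mem_slice] at hX ⊢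
    exact ⟨(mem_inter.1 hX.1).1, hX.2⟩
  have hmain := card_mul_le_card_mul (s := slice W U ℬ) (t := slice U W (𝒳 ∩ V.powersetCard p))
    (fun B X => Disjoint X B) (m := (#V - #U - q).choose (p - #U))
    (n := (#V - #W - p).choose (q - #W)) ?_ ?_
  -- With `g = #V - p - q` both degrees are binomials with lower index `g`, and `h` compares the
  -- upper indices.
  · have hle : (#V - #W - p).choose (q - #W) ≤ (#V - #U - q).choose (p - #U) := by
      obtain ⟨g, hg⟩ := Nat.exists_eq_add_of_le hpq
      have e1 : #V - #W - p = (q - #W) + g := by omega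
      have e2 : #V - #U - q = (p - #U) + g := by omega
      rw [e1, e2, Nat.choose_symm_add, Nat.choose_symm_add]
      exact Nat.choose_le_choose g (by omega)
    have hpos : 0 < (#V - #U - q).choose (p - #U) := Nat.choose_pos (by omega)
    have : #(slice W U ℬ) ≤ #(slice U W (𝒳 ∩ V.powersetCard p)) :=
      Nat.le_of_mul_le_mul_right (hmain.trans (Nat.mul_le_mul_left _ hle)) hpos
    have := this.trans (card_le_card hsub)
    unfold excess
    have h' : (#(slice W U ℬ) : ℤ) ≤ #(slice U W 𝒳) := by exact_mod_cast this
    linarith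
  · intro B hB
    rw [mem_slice] at hB
    have hBV := mem_powersetCard.1 (hℬ hB.1)
    rw [← hBV.2, ← card_slice_powersetCard hU hBV.1 hB.2.2.symm (by omega)]
    refine card_le_card fun X hX => ?_
    rw [mem_slice] at hX
    rw [mem_bipartiteAbove, mem_slice, mem_inter]
    exact ⟨⟨⟨h𝒳 X hX.1 B hB.1 hX.2.2, hX.1⟩, hX.2.1, disjoint_of_subset_right hB.2.1 hX.2.2⟩,
      hX.2.2⟩
  · intro X hX
    rw [mem_slice, mem_inter] at hX
    have hXV := mem_powersetCard.1 hX.1.2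
    rw [← hXV.2, ← card_slice_powersetCard hW hXV.1 hX.2.2.symm (by omega)]
    refine card_le_card fun B hB => ?_
    rw [mem_bipartiteBelow, mem_slice] at hB
    rw [mem_slice]
    exact ⟨hℬ hB.1.1, hB.1.2.1, hB.2.symm⟩

end Slices

/-! ### Kruskal–Katona in colex order. -/

open Finset.Colex in
theorem exists_isInitSeg_card (n r N : ℕ) (h : N ≤ n.choose r) :
    ∃ 𝒞 : Finset (Finset (Fin n)), IsInitSeg 𝒞 r ∧ #𝒞 = N := by
  induction N with
  | zero => exact ⟨∅, isInitSeg_empty, rfl⟩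
  | succ N ih =>
    obtain ⟨𝒞, h𝒞, hN⟩ := ih (by omega)
    have hne : ((univ.powersetCard r : Finset (Finset (Fin n))) \ 𝒞).Nonempty := by
      rw [sdiff_nonempty]
      intro hsub
      have := card_le_card hsub
      rw [card_powersetCard, card_univ, Fintype.card_fin] at this
      omega
    obtain ⟨s, hs, hmin⟩ := exists_min_image _ (toColex : Finset (Fin n) → Colex _) hne
    rw [mem_sdiff, mem_powersetCard] at hs
    refine ⟨insert s 𝒞, ⟨?_, ?_⟩, by rw [card_insert_of_notMem hs.2, hN]⟩
    · intro t ht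
      rcases mem_insert.1 (mem_coe.1 ht) with rfl | ht
      · exact hs.1.2
      · exact h𝒞.1 ht
    · rintro t u ht ⟨hut, hu⟩
      rcases mem_insert.1 ht with rfl | ht
      · by_contra hu'
        have := hmin u (mem_sdiff.2 ⟨mem_powersetCard.2 ⟨subset_univ _, hu⟩,
          fun h => hu' (mem_insert_of_mem h)⟩)
        exact absurd hut (not_lt.2 this)
      · exact mem_insert_of_mem (h𝒞.2 ht ⟨hut, hu⟩)

theorem toColex_compl_le {n : ℕ} {s t : Finset (Fin n)} (h : toColex s ≤ toColex t) :
    toColex tᶜ ≤ toColex sᶜ := by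
  rw [Colex.toColex_le_toColex] at h ⊢
  intro a ha ha'
  rw [mem_compl] at ha ha'
  obtain ⟨b, hb, hb', hab⟩ := h (not_not.1 ha') ha
  exact ⟨b, by simpa using hb', by simpa using hb, hab⟩

theorem toColex_compl_lt {n : ℕ} {s t : Finset (Fin n)} (h : toColex s < toColex t) :
    toColex tᶜ < toColex sᶜ := by
  refine lt_of_le_of_ne (toColex_compl_le h.le) fun he => h.ne ?_
  rw [toColex_inj, compl_inj_iff] at he
  rw [he]

/-- `ℬ` is closed under passing to colexicographically larger sets of size `q`. -/
def IsColexUpper {n : ℕ} (q : ℕ) (ℬ : Finset (Finset (Fin n))) : Prop :=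
  ∀ B ∈ ℬ, ∀ B' : Finset (Fin n), #B' = q → toColex B < toColex B' → B' ∈ ℬ

/-- The Kruskal-Katona theorem for pairs of cross-intersecting families. -/
theorem exists_isColexUpper {α : Type*} [DecidableEq α] {V : Finset α} {p q : ℕ}
    {ℬ 𝒳 : Finset (Finset α)} (hℬ : ℬ ⊆ V.powersetCard q) (h𝒳 : Blocks V p ℬ 𝒳)
    (hpq : p + q ≤ #V) :
    ∃ ℬ' 𝒳' : Finset (Finset (Fin #V)), ℬ' ⊆ univ.powersetCard q ∧ #ℬ' = #ℬ ∧ #𝒳' ≤ #𝒳 ∧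
      Blocks univ p ℬ' 𝒳' ∧ IsColexUpper q ℬ' := by
  let g : Fin #V ↪ α := V.equivFin.symm.toEmbedding.trans (Function.Embedding.subtype _)
  have hgV : (univ : Finset (Fin #V)).map g = V := by
    ext a
    simp only [mem_map, mem_univ, true_and, g, Function.Embedding.trans_apply,
      Equiv.coe_toEmbedding, Function.Embedding.subtype_apply]
    constructor
    · rintro ⟨i, rfl⟩
      exact (V.equivFin.symm i).2
    · intro ha
      exact ⟨V.equivFin ⟨a, ha⟩, by simp⟩
  let 𝒜 : Finset (Finset (Fin #V)) := univ.filter fun C => Cᶜ.map g ∈ ℬ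
  have h𝒜 : #𝒜 = #ℬ := by
    refine card_bij (fun C _ => Cᶜ.map g) (fun C hC => (mem_filter.1 hC).2) ?_ ?_
    · intro C _ D _ h
      exact compl_injective (map_injective g h)
    · intro B hB
      obtain ⟨C, -, hC⟩ := subset_map_iff.1
        ((mem_powersetCard.1 (hℬ hB)).1.trans hgV.symm.subset)
      refine ⟨Cᶜ, ?_, by rw [compl_compl, hC]⟩
      simp [𝒜, ← hC, hB]
  have h𝒜s : (𝒜 : Set (Finset (Fin #V))).Sized (#V - q) := by
    intro C hC
    have := (mem_powersetCard.1 (hℬ (mem_filter.1 (mem_coe.1 hC)).2)).2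
    rw [card_map, card_compl, Fintype.card_fin] at this
    have := card_le_univ C
    rw [Fintype.card_fin] at this
    omega
  have hle : #ℬ ≤ (#V).choose (#V - q) := by
    rw [Nat.choose_symm (by omega), ← card_powersetCard]
    exact card_le_card hℬ
  obtain ⟨𝒞, h𝒞, hcard⟩ := exists_isInitSeg_card _ _ _ hle
  -- A `p`-set is disjoint from a member of `ℬ` iff it lies in its complement, so these sets form
  -- the iterated shadow of the complements, `#V - q - p` levels down.
  have hkk := iterated_kk (k := #V - q - p) h𝒜s (hcard.trans h𝒜.symm).le h𝒞
  refine ⟨𝒞.compls, (Finset.shadow)^[#V - q - p] 𝒞, ?_, ?_, hkk.trans ?_, ?_, ?_⟩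
  · intro B hB
    rw [mem_compls] at hB
    have h1 := h𝒞.1 hB
    rw [card_compl, Fintype.card_fin] at h1
    have := card_le_univ B
    rw [Fintype.card_fin] at this
    exact mem_powersetCard.2 ⟨subset_univ _, by omega⟩
  · rw [card_compls, hcard]
  · refine card_le_card_of_injOn (fun X => X.map g) ?_ (map_injective g).injOn
    intro X hX
    rw [mem_coe, mem_shadow_iterate_iff_exists_mem_card_add] at hX
    obtain ⟨C, hC, hXC, hcX⟩ := hX
    have h1 := h𝒜s hC
    refine h𝒳 _ (mem_powersetCard.2 ⟨?_, ?_⟩) (Cᶜ.map g) (mem_filter.1 hC).2 ?_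
    · exact (map_subset_map.2 (subset_univ X)).trans hgV.subset
    · rw [card_map]; omega
    · rw [disjoint_map]
      exact disjoint_of_subset_left hXC disjoint_compl_right
  · intro X hX B hB hXB
    rw [mem_powersetCard] at hX
    rw [mem_shadow_iterate_iff_exists_mem_card_add]
    rw [mem_compls] at hB
    refine ⟨Bᶜ, hB, ?_, ?_⟩
    · exact subset_compl_iff_disjoint_right.2 hXB
    · rw [h𝒞.1 hB, hX.2]; omega
  · intro B hB B' hB' hlt
    rw [mem_compls] at hB ⊢
    refine h𝒞.2 hB ⟨toColex_compl_lt hlt, ?_⟩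
    rw [card_compl, Fintype.card_fin, hB']

theorem IsColexUpper.subset_or_subset {n q : ℕ} {𝒜 ℬ : Finset (Finset (Fin n))}
    (h𝒜 : IsColexUpper q 𝒜) (hℬ : IsColexUpper q ℬ) (h𝒜q : 𝒜 ⊆ univ.powersetCard q)
    (hℬq : ℬ ⊆ univ.powersetCard q) : 𝒜 ⊆ ℬ ∨ ℬ ⊆ 𝒜 := by
  by_contra! h
  obtain ⟨A, hA, hA'⟩ := not_subset.1 h.1
  obtain ⟨B, hB, hB'⟩ := not_subset.1 h.2
  rcases lt_trichotomy (toColex A) (toColex B) with hlt | heq | hlt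
  · exact hB' (h𝒜 A hA B (mem_powersetCard.1 (hℬq hB)).2 hlt)
  · exact hA' (toColex_inj.1 heq ▸ hB)
  · exact hA' (hℬ B hB A (mem_powersetCard.1 (h𝒜q hA)).2 hlt)

theorem IsColexUpper.subset_of_card_le {n q : ℕ} {𝒜 ℬ : Finset (Finset (Fin n))}
    (h𝒜 : IsColexUpper q 𝒜) (hℬ : IsColexUpper q ℬ) (h𝒜q : 𝒜 ⊆ univ.powersetCard q)
    (hℬq : ℬ ⊆ univ.powersetCard q) (h : #𝒜 ≤ #ℬ) : 𝒜 ⊆ ℬ := by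
  rcases h𝒜.subset_or_subset hℬ h𝒜q hℬq with hs | hs
  · exact hs
  · exact (eq_of_subset_of_card_le hs h).symm.subset

/-- The `j` largest elements of `Fin n`. -/
def top (n j : ℕ) : Finset (Fin n) := univ.filter fun i => n ≤ i + j

theorem mem_top {n j : ℕ} {i : Fin n} : i ∈ top n j ↔ n ≤ i + j := by
  simp [top]

theorem card_top {n j : ℕ} (h : j ≤ n) : #(top n j) = j := by
  have : (top n j).map Fin.valEmbedding = Ico (n - j) n := by
    ext a
    simp only [mem_map, mem_top, Fin.valEmbedding_apply, mem_Ico]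
    constructor
    · rintro ⟨i, hi, rfl⟩
      have := i.2
      omega
    · rintro ⟨h1, h2⟩
      exact ⟨⟨a, h2⟩, by simp; omega, rfl⟩
  rw [← card_map Fin.valEmbedding, this, Nat.card_Ico]
  omega

theorem isColexUpper_slice_top (n j q : ℕ) :
    IsColexUpper q (slice (top n j) ∅ (univ.powersetCard q)) := by
  intro B hB B' hB' hlt
  rw [mem_slice] at hB ⊢
  refine ⟨mem_powersetCard.2 ⟨subset_univ _, hB'⟩, fun x hx => ?_, disjoint_empty_right _⟩
  by_contra hx'
  obtain ⟨y, hy, hy', hxy⟩ := Colex.toColex_le_toColex.1 hlt.le (hB.2.1 hx) hx'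
  refine hy' (hB.2.1 ?_)
  rw [mem_top] at hx ⊢
  have : (x : ℕ) ≤ y := hxy
  omega

theorem IsColexUpper.top_subset {n j q : ℕ} {ℬ : Finset (Finset (Fin n))}
    (h : IsColexUpper q ℬ) (hℬ : ℬ ⊆ univ.powersetCard q) (hj : j ≤ q) (hq : q ≤ n)
    (hcard : #ℬ ≤ (n - j).choose (q - j)) {B : Finset (Fin n)} (hB : B ∈ ℬ) : top n j ⊆ B := by
  have hc : #(slice (top n j) ∅ (univ.powersetCard q)) = (n - j).choose (q - j) := by
    rw [card_slice_powersetCard (subset_univ _) (empty_subset _) (disjoint_empty_right _)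
      (by rwa [card_top (by omega)]), card_top (by omega)]
    simp
  have := h.subset_of_card_le (isColexUpper_slice_top n j q) hℬ (filter_subset _ _)
    (hcard.trans hc.ge) hB
  exact (mem_slice.1 this).2.1

theorem IsColexUpper.mem_of_top_subset {n j q : ℕ} {ℬ : Finset (Finset (Fin n))}
    (h : IsColexUpper q ℬ) (hℬ : ℬ ⊆ univ.powersetCard q) (hj : j ≤ q) (hq : q ≤ n)
    (hcard : (n - j).choose (q - j) ≤ #ℬ) {B : Finset (Fin n)} (hB : #B = q)
    (hBt : top n j ⊆ B) : B ∈ ℬ := by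
  have hc : #(slice (top n j) ∅ (univ.powersetCard q)) = (n - j).choose (q - j) := by
    rw [card_slice_powersetCard (subset_univ _) (empty_subset _) (disjoint_empty_right _)
      (by rwa [card_top (by omega)]), card_top (by omega)]
    simp
  refine (isColexUpper_slice_top n j q).subset_of_card_le h (filter_subset _ _) hℬ
    (hc.le.trans hcard) ?_
  exact mem_slice.2 ⟨mem_powersetCard.2 ⟨subset_univ _, hB⟩, hBt, disjoint_empty_right _⟩

/-- If `ℬ` is not too large, then it has at most as many members as there are `p`-sets disjoint
from one of them. -/
theorem card_le_card_of_blocks {α : Type*} [DecidableEq α] {V : Finset α} {p q : ℕ}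
    {ℬ 𝒳 : Finset (Finset α)} (hℬ : ℬ ⊆ V.powersetCard q) (h𝒳 : Blocks V p ℬ 𝒳)
    (hpq : p + q ≤ #V) (h : p ≤ q) (hcard : #ℬ ≤ (#V - q + p).choose p) : #ℬ ≤ #𝒳 := by
  obtain ⟨ℬ', 𝒳', h1, h2, h3, h4, h5⟩ := exists_isColexUpper hℬ h𝒳 hpq
  rw [← h2]
  refine le_trans ?_ h3
  -- The size bound puts `q - p` common elements into all compressed members; taking them as `W`
  -- makes double counting applicable with `U = ∅`.
  have ht : ∀ B ∈ ℬ', top #V (q - p) ⊆ B := fun B hB =>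
    h5.top_subset h1 (by omega) (by omega) (by
      rw [h2]
      convert hcard using 2 <;> omega) hB
  have hs : slice (top #V (q - p)) ∅ ℬ' = ℬ' :=
    filter_true_of_mem fun B hB => ⟨ht B hB, disjoint_empty_right _⟩
  have := excess_nonpos h1 h4 (empty_subset _) (subset_univ (top #V (q - p)))
    (by simpa using hpq) (by rw [card_top (by omega), card_empty]; omega)
  unfold excess at this
  rw [hs] at this
  have h6 : #ℬ' ≤ #(slice ∅ (top #V (q - p)) 𝒳') := by omega
  exact h6.trans (card_le_card (filter_subset _ _))

/-- Where `W` is too small for double counting, remove `W` from the members of `ℬ` and `U` from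
those of `𝒳`, and apply `card_le_card_of_blocks` inside `V \ (U ∪ W)`. The size of `W` cancels in
the resulting binomial. -/
theorem excess_nonpos_of_card_le {α : Type*} [DecidableEq α] {V : Finset α} {p q : ℕ}
    {ℬ 𝒳 : Finset (Finset α)} {U W : Finset α} (hℬ : ℬ ⊆ V.powersetCard q)
    (h𝒳 : Blocks V p ℬ 𝒳) (hU : U ⊆ V) (hW : W ⊆ V) (hpq : p + q ≤ #V) (hp : #U ≤ p)
    (hcard : #ℬ ≤ (#V - q + p - 2 * #U).choose (p - #U)) : excess ℬ 𝒳 U W ≤ 0 := by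
  by_cases h : q + #U ≤ p + #W
  · exact excess_nonpos hℬ h𝒳 hU hW hpq h
  by_cases hUW : Disjoint U W
  swap
  · exact excess_nonpos_of_slice_eq_empty fun B _ hWB hBU =>
      hUW ((disjoint_of_subset_left hWB hBU).symm)
  have hUWV : #(V \ (U ∪ W)) = #V - #U - #W := by
    rw [card_sdiff_of_subset (union_subset hU hW), card_union_of_disjoint hUW, Nat.sub_sub]
  have hc1 : #((slice W U ℬ).image (· \ W)) = #(slice W U ℬ) := by
    refine card_image_of_injOn fun A hA B hB hAB => ?_
    rw [mem_coe, mem_slice] at hA hB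
    rw [← union_sdiff_of_subset hA.2.1, ← union_sdiff_of_subset hB.2.1, show A \ W = B \ W from hAB]
  have hc2 : #((slice U W 𝒳).image (· \ U)) ≤ #(slice U W 𝒳) := card_image_le
  have := card_le_card_of_blocks (V := V \ (U ∪ W)) (p := p - #U) (q := q - #W)
    (ℬ := (slice W U ℬ).image (· \ W)) (𝒳 := (slice U W 𝒳).image (· \ U)) ?_ ?_
    (by rw [hUWV]; omega) (by omega) ?_
  · unfold excess
    have h' : (#(slice W U ℬ) : ℤ) ≤ #(slice U W 𝒳) := by
      exact_mod_cast (hc1.symm.le.trans this).trans hc2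
    linarith
  · intro B hB
    rw [mem_image] at hB
    obtain ⟨A, hA, rfl⟩ := hB
    rw [mem_slice] at hA
    have hAV := mem_powersetCard.1 (hℬ hA.1)
    rw [mem_powersetCard, card_sdiff_of_subset hA.2.1, hAV.2]
    refine ⟨fun a ha => ?_, rfl⟩
    rw [mem_sdiff] at ha
    have := disjoint_left.1 hA.2.2 ha.1
    simp [hAV.1 ha.1, ha.2, this]
  · intro X hX B hB hXB
    rw [mem_image] at hB
    obtain ⟨A, hA, rfl⟩ := hB
    rw [mem_slice] at hA
    rw [mem_powersetCard] at hX
    have hXU : Disjoint U X := disjoint_left.2 fun a ha hb => by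
      have := hX.1 hb
      simp [ha] at this
    have hXW : Disjoint X W := disjoint_left.2 fun a ha hb => by
      have := hX.1 ha
      simp [hb] at this
    refine mem_image.2 ⟨U ∪ X, mem_slice.2 ⟨h𝒳 _ (mem_powersetCard.2 ⟨?_, ?_⟩) A hA.1 ?_,
      subset_union_left, ?_⟩, ?_⟩
    · exact union_subset hU (hX.1.trans sdiff_subset)
    · rw [card_union_of_disjoint hXU, hX.2]; omega
    · rw [disjoint_union_left]
      refine ⟨hA.2.2.symm, disjoint_left.2 fun a ha hb => ?_⟩
      exact disjoint_left.1 hXB ha (mem_sdiff.2 ⟨hb, disjoint_left.1 hXW ha⟩)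
    · exact disjoint_union_left.2 ⟨hUW, hXW⟩
    · simp only [union_sdiff_left]
      exact Finset.sdiff_eq_self_iff_disjoint.2 hXU.symm
  · rw [hc1, hUWV]
    refine (card_le_card (filter_subset _ _)).trans (hcard.trans_eq ?_)
    by_cases hWq : #W ≤ q
    · congr 1; omega
    · omega

/-! ### Branching trees for a pair and for a triangle. -/

section Trees

variable {α : Type*} [DecidableEq α]

theorem card_slice_le_one {V U W : Finset α} {q : ℕ} {ℬ : Finset (Finset α)}
    (hℬ : ℬ ⊆ V.powersetCard q) (hW : q ≤ #W) : #(slice W U ℬ) ≤ 1 := by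
  rw [card_le_one]
  have key : ∀ A ∈ slice W U ℬ, A = W := fun A hA => by
    rw [mem_slice] at hA
    exact (eq_of_subset_of_card_le hA.2.1 (by rwa [(mem_powersetCard.1 (hℬ hA.1)).2])).symm
  intro A hA B hB
  rw [key A hA, key B hB]

theorem card_slice_eq_zero {V U W : Finset α} {q : ℕ} {ℬ : Finset (Finset α)}
    (hℬ : ℬ ⊆ V.powersetCard q) (hW : q < #W) : #(slice W U ℬ) ≤ 0 := by
  rw [Nat.le_zero, card_eq_zero, eq_empty_iff_forall_notMem]
  intro A hA
  rw [mem_slice] at hA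
  have := card_le_card hA.2.1
  have := (mem_powersetCard.1 (hℬ hA.1)).2
  omega

theorem excess_le_of_mem {V : Finset α} {p b : ℕ} {ℬ 𝒳 : Finset (Finset α)} {U W B : Finset α}
    (h𝒳 : Blocks V p ℬ 𝒳) (hB : B ∈ ℬ) (hBW : B ⊆ W) (hU : U ⊆ V) (hW : W ⊆ V)
    (hUW : Disjoint U W) (hp : #U ≤ p) (hb : #(slice W U ℬ) ≤ b) :
    excess ℬ 𝒳 U W ≤ b - ((#V - #U - #W).choose (p - #U) : ℕ) :=
  excess_le_of_slice_subset hU hW hUW hp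
    (fun X hX _ hXW => h𝒳 X hX B hB (disjoint_of_subset_right hBW hXW)) hb

/-- The bound for a family avoiding a point that has two members with at most `k - 2` common
elements. -/
theorem card_add_le_of_pair {V : Finset α} {k m : ℕ} {ℬ 𝒳 : Finset (Finset α)}
    (hℬ : ℬ ⊆ V.powersetCard k) (h𝒳 : Blocks V (k - 1) ℬ 𝒳) (hV : #V = m + k) (hkm : k ≤ m)
    (hk : 3 ≤ k) (h1 : #ℬ ≤ (m + k - 3).choose (k - 2)) (h2 : #ℬ ≤ (m + k - 5).choose (k - 3))
    {A B : Finset α} (hA : A ∈ ℬ) (hB : B ∈ ℬ) (hAB : #(A ∩ B) + 2 ≤ k) :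
    #ℬ + (m.choose (k - 1) + (m - 1).choose (k - 2) + (m - 2).choose (k - 2)) ≤ #𝒳 + 2 := by
  obtain ⟨hAV, hAc⟩ := mem_powersetCard.1 (hℬ hA)
  obtain ⟨hBV, hBc⟩ := mem_powersetCard.1 (hℬ hB)
  have leaf1 : ∀ i ∈ V, ∀ W ⊆ V, excess ℬ 𝒳 {i} W ≤ 0 := fun i hi W hW =>
    excess_nonpos_of_card_le hℬ h𝒳 (singleton_subset_iff.2 hi) hW (by omega)
      (by rw [card_singleton]; omega)
      (h1.trans_eq (by rw [card_singleton]; congr 1; omega))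
  have leaf2 : ∀ i ∈ V, ∀ j ∈ V, i ≠ j → ∀ W ⊆ V, excess ℬ 𝒳 {i, j} W ≤ 0 :=
    fun i hi j hj hij W hW =>
    excess_nonpos_of_card_le hℬ h𝒳 (insert_subset hi (singleton_subset_iff.2 hj)) hW (by omega)
      (by rw [card_pair hij]; omega)
      (h2.trans_eq (by rw [card_pair hij]; congr 1; omega))
  have hd : 1 < #(A \ B) := by
    have := card_sdiff_add_card_inter A B
    omega
  -- The surviving leaves `(U, W)` are `(∅, A)`, `({x}, B)` and `({y}, insert x B)`. They contain at
  -- most 1, 1 and 0 members of `ℬ`, the last because `#W = k + 1`; this gives the constant 2 and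
  -- the three binomials.
  obtain ⟨x, hx, y, hy, hxy⟩ := one_lt_card.1 hd
  rw [mem_sdiff] at hx hy
  have step1 : excess ℬ 𝒳 ∅ ∅ ≤ excess ℬ 𝒳 ∅ (A ∩ B) := by
    have := excess_le_excess_union (ℬ := ℬ) (𝒳 := 𝒳) (U := ∅) (W := ∅) (A ∩ B)
      fun i hi W' _ hW' _ => leaf1 i (hAV (mem_inter.1 hi).1) W'
        (hW'.trans (by simpa using inter_subset_left.trans hAV))
    simpa using this
  have hAB' : A ∩ B ⊆ V := inter_subset_left.trans hAV
  have bound : ∀ z ∈ A \ B, ∀ W ⊆ V, A ∩ B ⊆ W → z ∉ W →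
      excess ℬ 𝒳 {z} W ≤ excess ℬ 𝒳 {z} (W ∪ B) := by
    intro z hz W hW _ hzW
    rw [mem_sdiff] at hz
    refine excess_le_excess_union B fun i hi W' _ hW' _ => ?_
    exact leaf2 i (hBV hi) z (hAV hz.1) (fun h => hz.2 (h ▸ hi)) W'
      (hW'.trans (union_subset hW hBV))
  have step2 := excess_eq_add ℬ 𝒳 ∅ (A ∩ B) x
  have step3 := excess_eq_add ℬ 𝒳 ∅ (insert x (A ∩ B)) y
  have step4 : excess ℬ 𝒳 ∅ (insert y (insert x (A ∩ B))) ≤ excess ℬ 𝒳 ∅ A := by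
    have hs : insert y (insert x (A ∩ B)) ⊆ A :=
      insert_subset hy.1 (insert_subset hx.1 inter_subset_left)
    have := excess_le_excess_union (ℬ := ℬ) (𝒳 := 𝒳) (U := ∅)
      (W := insert y (insert x (A ∩ B))) A
      fun i hi W' _ hW' _ => leaf1 i (hAV hi) W'
        (hW'.trans (union_subset (hs.trans hAV) hAV))
    rwa [union_eq_right.2 hs] at this
  have leafA := excess_le_of_mem (U := ∅) (W := A) (b := 1) h𝒳 hA subset_rfl (empty_subset _) hAV
    (disjoint_empty_left _) (by simp) (card_slice_le_one hℬ hAc.ge)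
  have bx := bound x (mem_sdiff.2 hx) (A ∩ B) hAB' subset_rfl (by simp [hx.2])
  rw [union_eq_right.2 inter_subset_right] at bx
  have leafx := excess_le_of_mem (U := {x}) (W := B) (b := 1) h𝒳 hB subset_rfl
    (singleton_subset_iff.2 (hAV hx.1)) hBV (disjoint_singleton_left.2 hx.2)
    (by rw [card_singleton]; omega) (card_slice_le_one hℬ hBc.ge)
  have by' := bound y (mem_sdiff.2 hy) (insert x (A ∩ B)) (insert_subset (hAV hx.1) hAB')
    (subset_insert _ _) (by simp [hy.2, hxy.symm])
  have hxB : insert x (A ∩ B) ∪ B = insert x B := by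
    rw [insert_union, union_eq_right.2 inter_subset_right]
  rw [hxB] at by'
  have hcx : #(insert x B) = k + 1 := by rw [card_insert_of_notMem hx.2, hBc]
  have leafy := excess_le_of_mem (U := {y}) (W := insert x B) (b := 0) h𝒳 hB (subset_insert _ _)
    (singleton_subset_iff.2 (hAV hy.1)) (insert_subset (hAV hx.1) hBV)
    (disjoint_singleton_left.2 (by simp [hy.2, hxy.symm]))
    (by rw [card_singleton]; omega) (card_slice_eq_zero hℬ (by omega))
  rw [card_empty, hAc, hV] at leafA
  rw [card_singleton, hBc, hV] at leafx
  rw [card_singleton, hcx, hV] at leafy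
  rw [show m + k - 0 - k = m by omega, show k - 1 - 0 = k - 1 by omega] at leafA
  rw [show m + k - 1 - k = m - 1 by omega, show k - 1 - 1 = k - 2 by omega] at leafx
  rw [show m + k - 1 - (k + 1) = m - 2 by omega, show k - 1 - 1 = k - 2 by omega] at leafy
  rw [excess_empty] at step1
  rw [insert_empty_eq] at step2 step3
  push_cast at leafA leafx leafy
  zify
  linarith

/-- The bound for a family avoiding a point that contains three `k`-subsets of a set of size
`k + 1`. -/
theorem card_add_le_of_triangle {V T : Finset α} {k m : ℕ} {ℬ 𝒳 : Finset (Finset α)}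
    (hℬ : ℬ ⊆ V.powersetCard k) (h𝒳 : Blocks V (k - 1) ℬ 𝒳) (hV : #V = m + k) (hkm : k ≤ m)
    (hk : 5 ≤ k) (hT : excess ℬ 𝒳 ∅ ∅ ≤ excess ℬ 𝒳 ∅ T) (hTk : #T + 2 = k) {a b c : α}
    (ha : a ∉ T) (hb : b ∉ T) (hc : c ∉ T) (hab : a ≠ b) (hac : a ≠ c) (hbc : b ≠ c)
    (hTab : insert a (insert b T) ∈ ℬ) (hTac : insert a (insert c T) ∈ ℬ)
    (hTbc : insert b (insert c T) ∈ ℬ) :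
    #ℬ + (m.choose (k - 1) + 2 * (m - 1).choose (k - 2)) ≤ #𝒳 + 3 := by
  obtain ⟨hV1, -⟩ := mem_powersetCard.1 (hℬ hTab)
  obtain ⟨hV2, -⟩ := mem_powersetCard.1 (hℬ hTbc)
  simp only [insert_subset_iff] at hV1 hV2
  obtain ⟨haV, hbV, hTV⟩ := hV1
  obtain ⟨-, hcV, -⟩ := hV2
  have leaf2 : ∀ i ∈ V, ∀ j ∈ V, ∀ W ⊆ V, T ⊆ W → excess ℬ 𝒳 {i, j} W ≤ 0 := by
    intro i hi j hj W hW hTW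
    have h1 := card_le_card hTW
    have h2 := card_le_two (a := i) (b := j)
    -- The inequality `k + 2 ≤ (k - 1) + (k - 2)` is exactly `5 ≤ k`.
    exact excess_nonpos hℬ h𝒳 (insert_subset hi (singleton_subset_iff.2 hj)) hW (by omega)
      (by omega)
  -- The surviving leaves are `U = {a}` with `W = T ∪ {b, c}`, `U = {b}` with `W = T ∪ {a, c}`, and
  -- `U = ∅` with `W = T ∪ {a, b}`; each `W` is a member of `ℬ`.
  have e1 := excess_eq_add ℬ 𝒳 ∅ T a
  have e2 := excess_eq_add ℬ 𝒳 {a} T b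
  have e3 := excess_eq_add ℬ 𝒳 {a} (insert b T) c
  have e4 := excess_eq_add ℬ 𝒳 ∅ (insert a T) b
  have e5 := excess_eq_add ℬ 𝒳 {b} (insert a T) c
  rw [insert_empty_eq] at e1 e4
  have l1 := leaf2 b hbV a haV T hTV subset_rfl
  have l2 := leaf2 c hcV a haV (insert b T) (insert_subset hbV hTV) (subset_insert _ _)
  have l3 := leaf2 c hcV b hbV (insert a T) (insert_subset haV hTV) (subset_insert _ _)
  have leaf : ∀ x y z, x ∈ V → y ∈ V → z ∈ V → x ∉ T → y ∉ T → z ∉ T → x ≠ y → x ≠ z → y ≠ z →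
      insert y (insert z T) ∈ ℬ →
      excess ℬ 𝒳 {x} (insert y (insert z T)) ≤ 1 - ((m - 1).choose (k - 2) : ℕ) := by
    intro x y z hx hy hz hxT hyT hzT hxy hxz hyz hmem
    have hcard := (mem_powersetCard.1 (hℬ hmem)).2
    have := excess_le_of_mem (U := {x}) (b := 1) h𝒳 hmem subset_rfl
      (singleton_subset_iff.2 hx) (insert_subset hy (insert_subset hz hTV))
      (disjoint_singleton_left.2 (by simp [hxy, hxz, hxT]))
      (by rw [card_singleton]; omega) (card_slice_le_one hℬ hcard.ge)
    rw [card_singleton, hcard, hV, show m + k - 1 - k = m - 1 by omega,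
      show k - 1 - 1 = k - 2 by omega] at this
    exact_mod_cast this
  have la := leaf a c b haV hcV hbV ha hc hb hac hab hbc.symm (by rwa [insert_comm])
  have lb := leaf b c a hbV hcV haV hb hc ha hbc hab.symm hac.symm (by rwa [insert_comm])
  have hTba : insert b (insert a T) ∈ ℬ := by rwa [insert_comm]
  have hcard := (mem_powersetCard.1 (hℬ hTba)).2
  have l0 := excess_le_of_mem (U := ∅) (b := 1) h𝒳 hTba subset_rfl (empty_subset _)
    (insert_subset hbV (insert_subset haV hTV)) (disjoint_empty_left _) (by simp)
    (card_slice_le_one hℬ hcard.ge)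
  rw [card_empty, hcard, hV, show m + k - 0 - k = m by omega,
    show k - 1 - 0 = k - 1 by omega] at l0
  rw [excess_empty] at hT
  push_cast at l0
  zify
  linarith

end Trees

/-! ### Cross-intersecting bounds for larger families. -/

/-- Let `T` be the top `q - 2` elements and `a`, `b` the next two. The colex-largest `2 * m + 1`
sets are the `m + 1` sets containing `insert a T` and the `m` sets containing `insert b T` but not
`a`, so `ℬ` contains them all. The leaves `W = insert b T` (with `U = {a}`) and `W = insert a T`
(with `U = ∅`) yield the two binomials. -/
theorem card_add_le_of_isColexUpper {m p q : ℕ} {ℬ 𝒳 : Finset (Finset (Fin (m + q)))}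
    (hℬ : ℬ ⊆ univ.powersetCard q) (h𝒳 : Blocks univ p ℬ 𝒳) (hu : IsColexUpper q ℬ)
    (hpm : p ≤ m) (hp : 4 ≤ p) (hq : 4 ≤ q) (j : ℕ) (hj : j + 2 ≤ q) (hqj : q + 1 ≤ p + j)
    (hle : #ℬ ≤ (m + q - j).choose (q - j)) (hge : 2 * m + 1 ≤ #ℬ) :
    #ℬ + (m.choose (p - 1) + (m + 1).choose p) ≤ #𝒳 + (2 * m + 1) := by
  have hv : #(univ : Finset (Fin (m + q))) = m + q := by simp
  set T := top (m + q) (q - 2) with hTdef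
  have hT : #T = q - 2 := card_top (by omega)
  let a : Fin (m + q) := ⟨m + 1, by omega⟩
  let b : Fin (m + q) := ⟨m, by omega⟩
  have hav : (a : ℕ) = m + 1 := rfl
  have hbv : (b : ℕ) = m := rfl
  have haT : a ∉ T := by rw [hTdef, mem_top, hav]; omega
  have hbT : b ∉ T := by rw [hTdef, mem_top, hbv]; omega
  have hab : a ≠ b := fun h => by
    have := congrArg Fin.val h
    omega
  have haTc : #(insert a T) = q - 1 := by rw [card_insert_of_notMem haT, hT]; omega
  have hbTc : #(insert b T) = q - 1 := by rw [card_insert_of_notMem hbT, hT]; omega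
  have hc1 : #(slice (insert a T) ∅ (univ.powersetCard q)) = m + 1 := by
    rw [card_slice_powersetCard (subset_univ _) (subset_univ _) (disjoint_empty_right _)
      (by omega), haTc, hv, card_empty, show q - (q - 1) = 1 by omega, Nat.choose_one_right]
    omega
  have hbTa : Disjoint (insert b T) {a} := by
    rw [disjoint_singleton_right]
    simp [hab, haT]
  have hc2 : #(slice (insert b T) {a} (univ.powersetCard q)) = m := by
    rw [card_slice_powersetCard (subset_univ _) (subset_univ _) hbTa
      (by omega), hbTc, hv, card_singleton, show q - (q - 1) = 1 by omega, Nat.choose_one_right]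
    omega
  have hMu : IsColexUpper q (slice (insert a T) ∅ (univ.powersetCard q) ∪
      slice (insert b T) {a} (univ.powersetCard q)) := by
    have key : ∀ B : Finset (Fin (m + q)), B ∈ slice (insert a T) ∅ (univ.powersetCard q) ∪
      slice (insert b T) {a} (univ.powersetCard q) ↔ #B = q ∧ T ⊆ B ∧ (a ∈ B ∨ b ∈ B) := by
      intro B
      simp only [mem_union, mem_slice, mem_powersetCard, subset_univ, true_and,
        insert_subset_iff, disjoint_empty_right, and_true, disjoint_singleton_right]
      tauto
    intro B hB B' hB' hlt
    rw [key] at hB ⊢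
    obtain ⟨hBq, hTB, hBab⟩ := hB
    have hTB' : T ⊆ B' := by
      intro x hx
      by_contra hx'
      obtain ⟨y, hy, hy', hxy⟩ := Colex.toColex_le_toColex.1 hlt.le (hTB hx) hx'
      refine hy' (hTB ?_)
      rw [hTdef, mem_top] at hx ⊢
      have : (x : ℕ) ≤ y := hxy
      omega
    refine ⟨hB', hTB', ?_⟩
    by_contra! hn
    obtain ⟨x, hxB, hx', hxm⟩ : ∃ x ∈ B, x ∉ B' ∧ m ≤ (x : ℕ) := by
      rcases hBab with h | h
      · exact ⟨a, h, hn.1, by omega⟩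
      · exact ⟨b, h, hn.2, by omega⟩
    obtain ⟨y, hy, hy', hxy⟩ := Colex.toColex_le_toColex.1 hlt.le hxB hx'
    have hxy' : (x : ℕ) ≤ y := hxy
    have hya : y ≠ a := fun h => hn.1 (h ▸ hy)
    have hyb : y ≠ b := fun h => hn.2 (h ▸ hy)
    refine hy' (hTB ?_)
    rw [hTdef, mem_top]
    have h1 : (y : ℕ) ≠ m + 1 := fun h => hya (Fin.ext h)
    have h2 : (y : ℕ) ≠ m := fun h => hyb (Fin.ext h)
    omega
  have hM := hMu.subset_of_card_le hu
    (union_subset (filter_subset _ _) (filter_subset _ _)) hℬ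
    ((card_union_le _ _).trans (by omega))
  -- The first `j` elements lie in every member, so the branches avoiding one of them are empty;
  -- from then on `q + 1 ≤ p + j` allows double counting.
  have s1 : excess ℬ 𝒳 ∅ ∅ ≤ excess ℬ 𝒳 ∅ (∅ ∪ top (m + q) j) :=
    excess_le_excess_union _ fun i hi W' _ _ _ => excess_nonpos_of_slice_eq_empty
      fun B hB _ hd => by
        have := hu.top_subset hℬ (by omega) (by omega) hle hB hi
        exact disjoint_right.1 hd (mem_insert_self i ∅) this
  have s2 : excess ℬ 𝒳 ∅ (top (m + q) j) ≤ excess ℬ 𝒳 ∅ (top (m + q) j ∪ T) :=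
    excess_le_excess_union _ fun i hi W' hW' _ _ => by
      refine excess_nonpos hℬ h𝒳 (subset_univ _) (subset_univ _) (by omega) ?_
      have := card_le_card hW'
      rw [card_top (by omega)] at this
      rw [insert_empty_eq, card_singleton]
      omega
  have hjT : top (m + q) j ⊆ T := by
    intro x hx
    rw [hTdef, mem_top] at *
    omega
  rw [empty_union] at s1
  rw [union_eq_right.2 hjT] at s2
  have e1 := excess_eq_add ℬ 𝒳 ∅ T a
  have e2 := excess_eq_add ℬ 𝒳 {a} T b
  rw [insert_empty_eq] at e1
  have l1 : excess ℬ 𝒳 (insert b {a}) T ≤ 0 := by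
    refine excess_nonpos hℬ h𝒳 (subset_univ _) (subset_univ _) (by omega) ?_
    have := card_le_two (a := b) (b := a)
    omega
  -- Since `p + (q - 1) < m + q`, some `c` lies outside both `X` and `insert x T`, and `X` is
  -- disjoint from the member obtained by adding `c`.
  have exB : ∀ x ∉ T, (∀ c, c ∉ insert x T → insert c (insert x T) ∈ ℬ) →
      #(insert x T) = q - 1 → ∀ X ∈ univ.powersetCard p, Disjoint X (insert x T) → X ∈ 𝒳 := by
    intro x _ hmem hxc X hX hd
    have hcard : #(X ∪ insert x T) < #(univ : Finset (Fin (m + q))) := by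
      have := card_union_le X (insert x T)
      rw [(mem_powersetCard.1 hX).2, hxc] at this
      omega
    obtain ⟨c, -, hc⟩ := exists_mem_notMem_of_card_lt_card hcard
    rw [mem_union, not_or] at hc
    exact h𝒳 X hX _ (hmem c hc.2) (disjoint_insert_right.2 ⟨hc.1, hd⟩)
  have l2 : excess ℬ 𝒳 {a} (insert b T) ≤ m - (m.choose (p - 1) : ℕ) := by
    have := excess_le_of_slice_subset (ℬ := ℬ) (𝒳 := 𝒳) (U := {a}) (W := insert b T)
      (b := m) (p := p) (subset_univ _) (subset_univ _) hbTa.symm (by simp; omega)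
      (fun X hX _ hd => exB b hbT (fun c hc => hM ?_) hbTc X hX hd) ?_
    · rwa [card_singleton, hbTc, hv, show m + q - 1 - (q - 1) = m by omega] at this
    · by_cases hca : c = a
      · subst hca
        refine mem_union_left _ (mem_slice.2 ⟨mem_powersetCard.2 ⟨subset_univ _, ?_⟩, ?_,
          disjoint_empty_right _⟩)
        · rw [card_insert_of_notMem hc, hbTc]; omega
        · exact insert_subset_insert _ (subset_insert _ _)
      · refine mem_union_right _ (mem_slice.2 ⟨mem_powersetCard.2 ⟨subset_univ _, ?_⟩,
          subset_insert _ _, ?_⟩)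
        · rw [card_insert_of_notMem hc, hbTc]; omega
        · rw [disjoint_singleton_right]
          simp [hab, haT, Ne.symm hca]
    · exact (card_le_card (filter_subset_filter _ hℬ)).trans hc2.le
  have l3 : excess ℬ 𝒳 ∅ (insert a T) ≤ (m + 1 : ℕ) - ((m + 1).choose p : ℕ) := by
    have := excess_le_of_slice_subset (ℬ := ℬ) (𝒳 := 𝒳) (U := ∅) (W := insert a T)
      (b := m + 1) (p := p) (subset_univ _) (subset_univ _) (disjoint_empty_left _) (by simp)
      (fun X hX _ hd => exB a haT (fun c hc => hM ?_) haTc X hX hd) ?_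
    · rwa [card_empty, haTc, hv, show m + q - 0 - (q - 1) = m + 1 by omega, Nat.sub_zero] at this
    · refine mem_union_left _ (mem_slice.2 ⟨mem_powersetCard.2 ⟨subset_univ _, ?_⟩,
        subset_insert _ _, disjoint_empty_right _⟩)
      rw [card_insert_of_notMem hc, haTc]; omega
    · exact (card_le_card (filter_subset_filter _ hℬ)).trans hc1.le
  rw [excess_empty] at s1
  push_cast at l3
  zify
  linarith

/-- The bound for cross-intersecting families that are neither too small nor too large. -/
theorem card_add_le_of_two_mul_lt_card {α : Type*} [DecidableEq α] {V : Finset α} {m p q : ℕ}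
    {ℬ 𝒳 : Finset (Finset α)} (hV : #V = m + q) (hℬ : ℬ ⊆ V.powersetCard q)
    (h𝒳 : Blocks V p ℬ 𝒳) (hpm : p ≤ m) (hp : 4 ≤ p) (hq : 4 ≤ q) (j : ℕ) (hj : j + 2 ≤ q)
    (hqj : q + 1 ≤ p + j) (hle : #ℬ ≤ (m + q - j).choose (q - j)) (hge : 2 * m + 1 ≤ #ℬ) :
    #ℬ + (m.choose (p - 1) + (m + 1).choose p) ≤ #𝒳 + (2 * m + 1) := by
  obtain ⟨ℬ', 𝒳', h1, h2, h3, h4, h5⟩ := exists_isColexUpper hℬ h𝒳 (by omega)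
  generalize #V = v at *
  subst hV
  have := card_add_le_of_isColexUpper h1 h4 h5 hpm hp hq j hj hqj (by omega) (by omega)
  omega

/-- After compression `ℬ` contains the full star of the top element, and any `p`-set avoiding that
element is disjoint from a member of this star. -/
theorem choose_le_card_of_choose_le_card {α : Type*} [DecidableEq α] {V : Finset α} {p q : ℕ}
    {ℬ 𝒳 : Finset (Finset α)} (hℬ : ℬ ⊆ V.powersetCard q) (h𝒳 : Blocks V p ℬ 𝒳)
    (hpq : p + q ≤ #V) (hq : 1 ≤ q) (h : (#V - 1).choose (q - 1) ≤ #ℬ) :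
    (#V - 1).choose p ≤ #𝒳 := by
  obtain ⟨ℬ', 𝒳', h1, h2, h3, h4, h5⟩ := exists_isColexUpper hℬ h𝒳 hpq
  refine le_trans ?_ h3
  have hc : #(slice ∅ (top #V 1) (univ.powersetCard p)) = (#V - 1).choose p := by
    rw [card_slice_powersetCard (empty_subset _) (subset_univ _) (disjoint_empty_left _)
      (by simp), card_top (by omega)]
    simp
  rw [← hc]
  refine card_le_card fun X hX => ?_
  rw [mem_slice] at hX
  have hXc := (mem_powersetCard.1 hX.1).2
  obtain ⟨B, htB, hBX, hB⟩ := exists_subsuperset_card_eq (s := top #V 1) (t := Xᶜ) (n := q)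
    (subset_compl_iff_disjoint_right.2 hX.2.2.symm) (by rw [card_top (by omega)]; omega)
    (by rw [card_compl, Fintype.card_fin]; omega)
  exact h4 X hX.1 B (h5.mem_of_top_subset h1 hq (by omega) (by omega) hB htB)
    (disjoint_of_subset_right hBX disjoint_compl_right)

/-! ### Intersecting families in terms of `ℬ` and `𝒳`, and the size of `familyJ n k 3`. -/

/-- All members of `F` that avoid some fixed point have `k - 1` common elements. -/
def IsStructured (n k : ℕ) (F : Finset (Finset ℕ)) : Prop :=
  ∃ x ∈ ground n, ∃ S : Finset ℕ, #S = k - 1 ∧ ∀ A ∈ avoiding x F, S ⊆ A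

theorem mem_avoiding {x : ℕ} {F : Finset (Finset ℕ)} {A : Finset ℕ} :
    A ∈ avoiding x F ↔ A ∈ F ∧ x ∉ A := by
  simp [avoiding]

theorem card_ground (n : ℕ) : #(ground n) = n := by
  simp [ground]

theorem mem_ground {n a : ℕ} : a ∈ ground n ↔ 1 ≤ a ∧ a ≤ n := by
  simp [ground]

theorem card_interval (k i : ℕ) : #(interval k i) = k := by
  simp [interval]

/-- The `k - 1`-sets whose extension by `x` is not in `F`. -/
def missing (n k x : ℕ) (F : Finset (Finset ℕ)) : Finset (Finset ℕ) :=
  (((ground n).erase x).powersetCard (k - 1)).filter fun X => insert x X ∉ F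

theorem IsIntersectingFamily.avoiding_subset {n k : ℕ} {F : Finset (Finset ℕ)}
    (hF : IsIntersectingFamily n k F) (x : ℕ) :
    avoiding x F ⊆ ((ground n).erase x).powersetCard k := by
  intro A hA
  rw [mem_avoiding] at hA
  have := mem_powersetCard.1 (hF.1 hA.1)
  exact mem_powersetCard.2 ⟨fun a ha => mem_erase.2 ⟨fun h => hA.2 (h ▸ ha), this.1 ha⟩, this.2⟩

theorem IsIntersectingFamily.blocks {n k : ℕ} {F : Finset (Finset ℕ)}
    (hF : IsIntersectingFamily n k F) (x : ℕ) :
    Blocks ((ground n).erase x) (k - 1) (avoiding x F) (missing n k x F) := by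
  intro X hX B hB hXB
  rw [mem_avoiding] at hB
  refine mem_filter.2 ⟨hX, fun h => ?_⟩
  obtain ⟨y, hy⟩ := hF.2 _ h _ hB.1
  rw [mem_inter, mem_insert] at hy
  rcases hy with ⟨rfl | hy, hyB⟩
  · exact hB.2 hyB
  · exact disjoint_left.1 hXB hy hyB

theorem IsIntersectingFamily.card_add_card_missing {n k x : ℕ} {F : Finset (Finset ℕ)}
    (hF : IsIntersectingFamily n k F) (hx : x ∈ ground n) :
    #F + #(missing n k x F) = (n - 1).choose (k - 1) + #(avoiding x F) := by
  have h1 : #F = #(F.filter fun A => x ∈ A) + #(avoiding x F) :=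
    (card_filter_add_card_filter_not (s := F) (fun A => x ∈ A)).symm
  have h2 : #(((ground n).erase x).powersetCard (k - 1)) = (n - 1).choose (k - 1) := by
    rw [card_powersetCard, card_erase_of_mem hx, card_ground]
  have h3 := card_filter_add_card_filter_not (s := ((ground n).erase x).powersetCard (k - 1))
    (fun X => insert x X ∈ F)
  have h4 : #(F.filter fun A => x ∈ A) =
      #((((ground n).erase x).powersetCard (k - 1)).filter fun X => insert x X ∈ F) := by
    refine card_bij' (fun A _ => A.erase x) (fun X _ => insert x X) ?_ ?_ ?_ ?_
    · intro A hA
      rw [mem_filter] at hA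
      have := mem_powersetCard.1 (hF.1 hA.1)
      rw [mem_filter, insert_erase hA.2, mem_powersetCard, card_erase_of_mem hA.2, this.2]
      exact ⟨⟨erase_subset_erase x this.1, rfl⟩, hA.1⟩
    · intro X hX
      rw [mem_filter] at hX ⊢
      exact ⟨hX.2, mem_insert_self _ _⟩
    · intro A hA
      exact insert_erase (mem_filter.1 hA).2
    · intro X hX
      refine erase_insert fun h => ?_
      have := (mem_powersetCard.1 (mem_filter.1 hX).1).1 h
      simp at this
  unfold missing
  omega

/-- A lower bound for the size of `familyJ n k 3` (in fact the exact value). -/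
theorem le_card_familyJ {n k : ℕ} (hk : 5 ≤ k) (hn : 2 * k < n) :
    (n - 1).choose (k - 1) + 2 ≤ #(familyJ n k 3) + ((n - 1 - k).choose (k - 1) +
      (n - 2 - k).choose (k - 2) + (n - 3 - k).choose (k - 2)) := by
  set V := (ground n).erase 1 with hV
  have hVc : #V = n - 1 := by
    rw [hV, card_erase_of_mem (mem_ground.2 ⟨le_rfl, by omega⟩), card_ground]
  have hI1 : interval k 1 ⊆ V := fun a ha => by
    simp only [interval, mem_Icc] at ha
    simp only [hV, mem_erase, mem_ground]
    omega
  have hI3 : interval k 3 ⊆ V := fun a ha => by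
    simp only [interval, mem_Icc] at ha
    simp only [hV, mem_erase, mem_ground]
    omega
  have h2V : 2 ∈ V := by simp only [hV, mem_erase, mem_ground]; omega
  have h3V : 3 ∈ V := by simp only [hV, mem_erase, mem_ground]; omega
  have h2I : 2 ∉ interval k 3 := by simp [interval]
  have h3I : 3 ∉ interval k 3 := by simp [interval]
  let P := V.powersetCard (k - 1)
  let G := P.filter fun X => (X ∩ interval k 1).Nonempty ∧ (X ∩ interval k 3).Nonempty
  have hne : interval k 1 ≠ interval k 3 := fun h => h2I (h ▸ by simp [interval]; omega)
  have h1I : ∀ i ∈ ({1, 3} : Finset ℕ), 1 ∉ interval k i := by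
    intro i hi
    simp only [interval, mem_Icc]
    simp at hi
    omega
  have hJ : 2 + #G ≤ #(familyJ n k 3) := by
    have hd : Disjoint ({interval k 1, interval k 3} : Finset (Finset ℕ))
        (G.image (insert 1)) := by
      rw [disjoint_left]
      intro A hA hA'
      obtain ⟨X, -, rfl⟩ := mem_image.1 hA'
      rw [mem_insert, mem_singleton] at hA
      rcases hA with h | h
      · exact h1I 1 (by simp) (h ▸ mem_insert_self _ _)
      · exact h1I 3 (by simp) (h ▸ mem_insert_self _ _)
    have hc : #(G.image (insert 1)) = #G := by
      refine card_image_of_injOn fun X hX Y hY hXY => ?_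
      have key : ∀ X ∈ G, (insert 1 X).erase 1 = X := fun X hX => by
        refine erase_insert fun h => ?_
        have := (mem_powersetCard.1 (mem_filter.1 hX).1).1 h
        simp [hV] at this
      rw [← key X hX, ← key Y hY, show insert 1 X = insert 1 Y from hXY]
    rw [← hc, ← card_pair hne, ← card_union_of_disjoint hd]
    refine card_le_card (union_subset_union_right ?_)
    intro A hA
    obtain ⟨X, hX, rfl⟩ := mem_image.1 hA
    rw [mem_filter, mem_powersetCard] at hX
    have h1X : 1 ∉ X := fun h => by
      have := hX.1.1 h
      simp [hV] at this
    refine mem_filter.2 ⟨mem_powersetCard.2 ⟨insert_subset (mem_ground.2 (by omega))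
      (hX.1.1.trans (erase_subset _ _)), ?_⟩, mem_insert_self _ _, ?_, ?_⟩
    · rw [card_insert_of_notMem h1X, hX.1.2]; omega
    · exact hX.2.1.mono (inter_subset_inter_right (subset_insert _ _))
    · exact hX.2.2.mono (inter_subset_inter_right (subset_insert _ _))
  -- As `interval k 1 \ interval k 3 = {2, 3}`, a set that meets the first interval but not the
  -- second contains 2, or contains 3 and not 2.
  have hP : P ⊆ G ∪ (slice ∅ (interval k 1) P ∪ (slice {2} (interval k 3) P ∪
      slice {3} (insert 2 (interval k 3)) P)) := by
    intro X hX
    simp only [mem_union, mem_slice, G, mem_filter, hX, true_and, empty_subset,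
      singleton_subset_iff, disjoint_insert_right]
    by_cases h1 : (X ∩ interval k 1).Nonempty
    swap
    · right; left
      rwa [disjoint_iff_inter_eq_empty, ← not_nonempty_iff_eq_empty]
    by_cases h3 : (X ∩ interval k 3).Nonempty
    · exact Or.inl ⟨h1, h3⟩
    rw [not_nonempty_iff_eq_empty, ← disjoint_iff_inter_eq_empty] at h3
    by_cases hX2 : 2 ∈ X
    · exact Or.inr (Or.inr (Or.inl ⟨hX2, h3⟩))
    refine Or.inr (Or.inr (Or.inr ⟨?_, hX2, h3⟩))
    obtain ⟨y, hy⟩ := h1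
    rw [mem_inter] at hy
    have hy3 : y ∉ interval k 3 := fun h => disjoint_left.1 h3 hy.1 h
    have : y = 2 ∨ y = 3 := by
      simp only [interval, mem_Icc] at hy hy3
      omega
    rcases this with rfl | rfl
    · exact absurd hy.1 hX2
    · exact hy.1
  have c1 : #(slice ∅ (interval k 1) P) = (n - 1 - k).choose (k - 1) := by
    rw [card_slice_powersetCard (empty_subset _) hI1 (disjoint_empty_left _) (by simp),
      card_interval, hVc]
    simp
  have c2 : #(slice {2} (interval k 3) P) = (n - 2 - k).choose (k - 2) := by
    rw [card_slice_powersetCard (singleton_subset_iff.2 h2V) hI3 (disjoint_singleton_left.2 h2I)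
      (by rw [card_singleton]; omega), card_interval, hVc, card_singleton]
    congr 1
  have c3 : #(slice {3} (insert 2 (interval k 3)) P) = (n - 3 - k).choose (k - 2) := by
    rw [card_slice_powersetCard (singleton_subset_iff.2 h3V) (insert_subset h2V hI3)
      (disjoint_singleton_left.2 (by simp [h3I]))
      (by rw [card_singleton]; omega), card_insert_of_notMem h2I, card_interval, hVc,
      card_singleton]
    congr 1
    omega
  have hPc : #P = (n - 1).choose (k - 1) := by rw [card_powersetCard, hVc]
  have := card_le_card hP
  have u1 := card_union_le G (slice ∅ (interval k 1) P ∪ (slice {2} (interval k 3) P ∪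
      slice {3} (insert 2 (interval k 3)) P))
  have u2 := card_union_le (slice ∅ (interval k 1) P) (slice {2} (interval k 3) P ∪
      slice {3} (insert 2 (interval k 3)) P)
  have u3 := card_union_le (slice {2} (interval k 3) P) (slice {3} (insert 2 (interval k 3)) P)
  omega

/-! ### Binomial inequalities. -/

section Binomials

theorem le_choose {a b : ℕ} (hb : 1 ≤ b) (hab : b + 1 ≤ a) : a ≤ a.choose b := by
  induction a with
  | zero => omega
  | succ a ih =>
    obtain ⟨b, rfl⟩ : ∃ b', b = b' + 1 := ⟨b - 1, by omega⟩
    obtain h | h := (by omega : a = b + 1 ∨ b + 1 + 1 ≤ a)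
    · rw [h, Nat.choose_succ_self_right]
    · have h1 := ih h
      have h2 : 0 < a.choose b := Nat.choose_pos (by omega)
      rw [Nat.choose_succ_succ' a b]
      omega

theorem choose_two_le_choose {a b : ℕ} (hb : 2 ≤ b) (hab : b + 2 ≤ a) :
    a.choose 2 ≤ a.choose b := by
  induction a with
  | zero => omega
  | succ a ih =>
    obtain h | h := (by omega : a + 1 = b + 2 ∨ b + 2 ≤ a)
    · rw [Nat.choose_symm_of_eq_add h]
    · obtain ⟨b, rfl⟩ : ∃ b', b = b' + 1 := ⟨b - 1, by omega⟩
      have h1 := ih h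
      have h2 := le_choose (a := a) (b := b) (by omega) (by omega)
      have e : (a + 1).choose 2 = a + a.choose 2 := by
        rw [Nat.choose_succ_succ' a 1, Nat.choose_one_right]
      rw [e, Nat.choose_succ_succ' a b]
      omega

theorem two_mul_choose_two (a : ℕ) : 2 * (a + 1).choose 2 = (a + 1) * a := by
  induction a with
  | zero => rfl
  | succ a ih =>
    rw [Nat.choose_succ_succ' (a + 1) 1, Nat.choose_one_right, mul_add, ih]
    ring

theorem two_mul_le_choose {k m : ℕ} (hk : 5 ≤ k) (hm : k ≤ m) :
    2 * m ≤ (m + k - 3).choose (k - 2) ∧ 2 * m ≤ (m + k - 5).choose (k - 3) := by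
  have h : 2 * m ≤ m.choose 2 := by
    obtain ⟨a, rfl⟩ : ∃ a, m = a + 1 := ⟨m - 1, by omega⟩
    have := two_mul_choose_two a
    nlinarith
  have h1 := Nat.choose_le_choose 2 (show m ≤ m + k - 3 by omega)
  have h2 := Nat.choose_le_choose 2 (show m ≤ m + k - 5 by omega)
  have h3 := choose_two_le_choose (a := m + k - 3) (b := k - 2) (by omega) (by omega)
  have h4 := choose_two_le_choose (a := m + k - 5) (b := k - 3) (by omega) (by omega)
  omega

theorem three_mul_lt_choose {k m : ℕ} (hk : 5 ≤ k) (hm : k ≤ m) :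
    3 * m < (m + k - 2).choose (k - 2) := by
  have h1 := two_mul_choose_two (m + 2)
  have h2 := Nat.choose_le_choose 2 (show m + 2 + 1 ≤ m + k - 2 by omega)
  have h3 := choose_two_le_choose (a := m + k - 2) (b := k - 2) (by omega) (by omega)
  nlinarith

/-- By Pascal's rule this is `3 * m ≤ 2 * (m - 1).choose (k - 3) + (m - 2).choose (k - 3)`, with
equality at `k = m = 5`. The slack `3 * m` absorbs the additive terms `2 * m + 1` and `m + 1` of the
two-point case. -/
theorem choose_add_three_mul_le {k m : ℕ} (hk : 5 ≤ k) (hm : k ≤ m) :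
    m.choose (k - 1) + (m - 1).choose (k - 2) + (m - 2).choose (k - 2) + 3 * m ≤
      m.choose (k - 2) + (m + 1).choose (k - 1) := by
  obtain ⟨b, rfl⟩ : ∃ b, k = b + 3 := ⟨k - 3, by omega⟩
  obtain ⟨a, rfl⟩ : ∃ a, m = a + 2 := ⟨m - 2, by omega⟩
  simp only [show b + 3 - 1 = b + 2 by omega, show b + 3 - 2 = b + 1 by omega,
    show a + 2 - 1 = a + 1 by omega, show a + 2 - 2 = a by omega]
  have e1 : (a + 2 + 1).choose (b + 2) = (a + 2).choose (b + 1) + (a + 2).choose (b + 2) :=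
    Nat.choose_succ_succ' (a + 2) (b + 1)
  have e2 : (a + 2).choose (b + 1) = (a + 1).choose b + (a + 1).choose (b + 1) :=
    Nat.choose_succ_succ' (a + 1) b
  have e3 := Nat.choose_succ_succ' a b
  have h1 := choose_two_le_choose (a := a + 1) (b := b) (by omega) (by omega)
  have h2 := le_choose (a := a) (b := b) (by omega) (by omega)
  have h3 := two_mul_choose_two a
  have h4 : 3 * (a + 2) ≤ (a + 1) * a + a := by nlinarith
  omega

end Binomials

/-! ### Unstructured families with few members avoiding some point. -/

/-- A family of `k`-sets without `k - 1` common elements contains two sets with at most `k - 2`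
common elements or three subsets of a set of size `k + 1`. -/
theorem exists_pair_or_triangle {V : Finset ℕ} {k : ℕ} {ℬ : Finset (Finset ℕ)}
    (hℬ : ℬ ⊆ V.powersetCard k) (hk : 2 ≤ k) (h : ∀ S : Finset ℕ, #S = k - 1 → ∃ A ∈ ℬ, ¬ S ⊆ A) :
    (∃ A ∈ ℬ, ∃ B ∈ ℬ, #(A ∩ B) + 2 ≤ k) ∨
      ∃ (T : Finset ℕ) (a b c : ℕ), #T + 2 = k ∧ a ∉ T ∧ b ∉ T ∧ c ∉ T ∧ a ≠ b ∧ a ≠ c ∧ b ≠ c ∧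
        insert a (insert b T) ∈ ℬ ∧ insert a (insert c T) ∈ ℬ ∧ insert b (insert c T) ∈ ℬ := by
  by_cases hpair : ∃ A ∈ ℬ, ∃ B ∈ ℬ, #(A ∩ B) + 2 ≤ k
  · exact Or.inl hpair
  right
  push Not at hpair
  have hc : ∀ A ∈ ℬ, #A = k := fun A hA => (mem_powersetCard.1 (hℬ hA)).2
  -- Any `(k-1)`-set serves here; only a member of `ℬ` is wanted.
  obtain ⟨A, hA, -⟩ := h (range (k - 1)) (card_range _)
  obtain ⟨S₀, hS₀, hS₀c⟩ := exists_subset_card_eq (s := A) (n := k - 1) (by rw [hc A hA]; omega)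
  obtain ⟨B, hB, hS₀B⟩ := h S₀ hS₀c
  have hAB : ¬ A ⊆ B := fun h => hS₀B (hS₀.trans h)
  obtain ⟨a, haA, haB⟩ := not_subset.1 hAB
  have hBA : ¬ B ⊆ A := fun h =>
    hAB (eq_of_subset_of_card_le h (by rw [hc A hA, hc B hB])).symm.subset
  obtain ⟨b, hbB, hbA⟩ := not_subset.1 hBA
  have hI := hpair A hA B hB
  have haI : a ∉ A ∩ B := fun h => haB (mem_inter.1 h).2
  have hbI : b ∉ A ∩ B := fun h => hbA (mem_inter.1 h).1
  have hAI : insert a (A ∩ B) = A := eq_of_subset_of_card_le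
    (insert_subset haA inter_subset_left) (by rw [card_insert_of_notMem haI, hc A hA]; omega)
  have hBI : insert b (A ∩ B) = B := eq_of_subset_of_card_le
    (insert_subset hbB inter_subset_right) (by rw [card_insert_of_notMem hbI, hc B hB]; omega)
  have hIc : #(A ∩ B) = k - 1 := by
    have := hc A hA
    rw [← hAI, card_insert_of_notMem haI] at this
    omega
  obtain ⟨C, hC, hIC⟩ := h (A ∩ B) hIc
  obtain ⟨s, hsI, hsC⟩ := not_subset.1 hIC
  -- Without a bad pair, `C` misses only one element of `D`, namely `s`. Applied to `A` and `B` this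
  -- forces `C` to be `A ∪ B` without `s`.
  have key : ∀ D ∈ ℬ, s ∈ D → D.erase s ⊆ C := by
    intro D hD hsD
    have h1 := hpair D hD C hC
    have h2 : D ∩ C ⊆ D.erase s := fun x hx => by
      rw [mem_inter] at hx
      exact mem_erase.2 ⟨fun h => hsC (h ▸ hx.2), hx.1⟩
    have h3 := eq_of_subset_of_card_le h2 (by rw [card_erase_of_mem hsD, hc D hD]; omega)
    rw [← h3]
    exact inter_subset_right
  have hsA := (mem_inter.1 hsI).1
  have hsB := (mem_inter.1 hsI).2
  have has : a ≠ s := fun h => haI (h ▸ hsI)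
  have hbs : b ≠ s := fun h => hbI (h ▸ hsI)
  have hab : a ≠ b := fun h => haB (h ▸ hbB)
  have hTc : #((A ∩ B).erase s) = k - 2 := by
    rw [card_erase_of_mem hsI, hIc]; omega
  have haT : a ∉ (A ∩ B).erase s := fun h => haI (mem_of_mem_erase h)
  have hbT : b ∉ (A ∩ B).erase s := fun h => hbI (mem_of_mem_erase h)
  refine ⟨(A ∩ B).erase s, s, a, b, by omega, notMem_erase _ _, haT, hbT, has.symm, hbs.symm,
    hab, ?_, ?_, ?_⟩
  · rwa [insert_comm, insert_erase hsI, hAI]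
  · rwa [insert_comm, insert_erase hsI, hBI]
  · have hsub : insert a (insert b ((A ∩ B).erase s)) ⊆ C := by
      refine insert_subset (key A hA hsA (mem_erase.2 ⟨has, haA⟩))
        (insert_subset (key B hB hsB (mem_erase.2 ⟨hbs, hbB⟩)) ?_)
      exact (erase_subset_erase s inter_subset_left).trans (key A hA hsA)
    rwa [eq_of_subset_of_card_le hsub (by
      rw [card_insert_of_notMem (by simp [hab, haI]), card_insert_of_notMem hbT, hTc, hc C hC]
      omega)]

theorem choose_add_le_of_triangle {k m : ℕ} (hk : 5 ≤ k) (hm : k ≤ m) :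
    m.choose (k - 1) + (m - 1).choose (k - 2) + (m - 2).choose (k - 2) + 1 ≤
      m.choose (k - 1) + 2 * (m - 1).choose (k - 2) := by
  obtain ⟨b, rfl⟩ : ∃ b, k = b + 3 := ⟨k - 3, by omega⟩
  obtain ⟨a, rfl⟩ : ∃ a, m = a + 2 := ⟨m - 2, by omega⟩
  simp only [show b + 3 - 2 = b + 1 by omega,
    show a + 2 - 1 = a + 1 by omega, show a + 2 - 2 = a by omega]
  have e3 := Nat.choose_succ_succ' a b
  have h : 0 < a.choose b := Nat.choose_pos (by omega)
  omega

/-- The common term `(n-1).choose (k-1)` cancels between `card_add_card_missing` and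
`le_card_familyJ`; what remains is the form in which the branching trees deliver their bounds. -/
theorem IsIntersectingFamily.card_le_card_familyJ_of_missing {n k x : ℕ} {F : Finset (Finset ℕ)}
    (hF : IsIntersectingFamily n k F) (hk : 5 ≤ k) (hn : 2 * k < n) (hx : x ∈ ground n)
    (h : #(avoiding x F) + ((n - 1 - k).choose (k - 1) + (n - 1 - k - 1).choose (k - 2) +
      (n - 1 - k - 2).choose (k - 2)) ≤ #(missing n k x F) + 2) :
    #F ≤ #(familyJ n k 3) := by
  have h1 := hF.card_add_card_missing hx
  have h2 := le_card_familyJ hk hn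
  rw [show n - 2 - k = n - 1 - k - 1 by omega, show n - 3 - k = n - 1 - k - 2 by omega] at h2
  omega

/-- An unstructured intersecting family of small diversity is not larger than `familyJ n k 3`. -/
theorem IsIntersectingFamily.card_le_of_card_avoiding_le {n k x : ℕ} {F : Finset (Finset ℕ)}
    (hF : IsIntersectingFamily n k F) (hk : 5 ≤ k) (hn : 2 * k < n) (hx : x ∈ ground n)
    (hns : ¬ IsStructured n k F) (h : #(avoiding x F) ≤ (n - 3).choose (k - 2)) :
    #F ≤ #(familyJ n k 3) := by
  refine hF.card_le_card_familyJ_of_missing hk hn hx ?_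
  obtain ⟨m, rfl⟩ : ∃ m, n = m + k + 1 := ⟨n - k - 1, by omega⟩
  have hkm : k ≤ m := by omega
  rw [show m + k + 1 - 1 - k = m by omega]
  have hV : #((ground (m + k + 1)).erase x) = m + k := by
    rw [card_erase_of_mem hx, card_ground]; omega
  have hℬ := hF.avoiding_subset x
  have h𝒳 := hF.blocks x
  by_cases hsmall : #(avoiding x F) ≤ 2 * m
  · have hb := two_mul_le_choose hk hkm
    have h1 := hsmall.trans hb.1
    have h2 := hsmall.trans hb.2
    have hS : ∀ S : Finset ℕ, #S = k - 1 → ∃ A ∈ avoiding x F, ¬ S ⊆ A := by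
      intro S hS
      by_contra! hcon
      exact hns ⟨x, hx, S, hS, hcon⟩
    rcases exists_pair_or_triangle hℬ (by omega) hS with ⟨A, hA, B, hB, hAB⟩ |
      ⟨T, a, b, c, hT, ha, hb, hc, hab, hac, hbc, hab', hac', hbc'⟩
    · exact card_add_le_of_pair hℬ h𝒳 hV hkm (by omega) h1 h2 hA hB hAB
    · have hTV : T ⊆ (ground (m + k + 1)).erase x :=
        ((subset_insert _ _).trans (subset_insert _ _)).trans
          (mem_powersetCard.1 (hℬ hab')).1
      have hchain : excess (avoiding x F) (missing (m + k + 1) k x F) ∅ ∅ ≤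
          excess (avoiding x F) (missing (m + k + 1) k x F) ∅ (∅ ∪ T) :=
        excess_le_excess_union T fun i hi W' _ hW' _ =>
          excess_nonpos_of_card_le hℬ h𝒳 (by simpa using hTV hi)
            (hW'.trans (by simpa using hTV)) (by omega) (by simp; omega)
            (h1.trans_eq (by rw [insert_empty_eq, card_singleton]; congr 1; omega))
      rw [empty_union] at hchain
      have := card_add_le_of_triangle hℬ h𝒳 hV hkm hk hchain hT ha hb hc hab hac hbc hab' hac' hbc'
      have := choose_add_le_of_triangle hk hkm
      omega
  -- With `q = k` and `p = k - 1`, `j = 2` is the least value with `q + 1 ≤ p + j`; it is the source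
  -- of the threshold `(n-3).choose (k-2)`.
  · have := card_add_le_of_two_mul_lt_card hV hℬ h𝒳 (by omega) (by omega) (by omega) 2 (by omega)
      (by omega) (h.trans_eq (by congr 1)) (by omega)
    have := choose_add_three_mul_le hk hkm
    rw [show k - 1 - 1 = k - 2 by omega] at *
    omega

/-! ### Families concentrated on two points. -/

/-- An intersecting family of large diversity in which most sets contain one of two given points
is not larger than `familyJ n k 3`. -/
theorem IsIntersectingFamily.card_le_of_two_points {n k i j : ℕ} {F : Finset (Finset ℕ)}
    (hF : IsIntersectingFamily n k F) (hk : 5 ≤ k) (hn : 2 * k < n) (hi : i ∈ ground n)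
    (hj : j ∈ ground n) (hij : i ≠ j) (hN : #(F.filter fun A => i ∉ A ∧ j ∉ A) ≤ n - k)
    (hi' : (n - 3).choose (k - 2) < #(avoiding i F))
    (hle : #(F.filter fun A => j ∈ A ∧ i ∉ A) ≤ #(F.filter fun A => i ∈ A ∧ j ∉ A)) :
    #F ≤ #(familyJ n k 3) := by
  obtain ⟨m, rfl⟩ : ∃ m, n = m + k + 1 := ⟨n - k - 1, by omega⟩
  have hkm : k ≤ m := by omega
  set V := ((ground (m + k + 1)).erase i).erase j with hVdef
  have hV : #V = m + (k - 1) := by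
    rw [hVdef, card_erase_of_mem (mem_erase.2 ⟨hij.symm, hj⟩), card_erase_of_mem hi, card_ground]
    omega
  have memV : ∀ a, a ∈ V ↔ a ≠ j ∧ a ≠ i ∧ a ∈ ground (m + k + 1) := fun a => by
    simp [hVdef]
  have card_link : ∀ x : ℕ, ∀ G : Finset (Finset ℕ), (∀ A ∈ G, x ∈ A) →
      #(G.image fun A => A.erase x) = #G := by
    intro x G hG
    refine card_image_of_injOn fun A hA B hB hAB => ?_
    rw [← insert_erase (hG A hA), ← insert_erase (hG B hB), show A.erase x = B.erase x from hAB]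
  set P₀ := F.filter fun A => i ∈ A ∧ j ∉ A with hP₀
  set Q₀ := F.filter fun A => j ∈ A ∧ i ∉ A with hQ₀
  let P := P₀.image fun A => A.erase i
  let Q := Q₀.image fun A => A.erase j
  have hP : #P = #P₀ := card_link i P₀ fun A hA => (mem_filter.1 hA).2.1
  have hQ : #Q = #Q₀ := card_link j Q₀ fun A hA => (mem_filter.1 hA).2.1
  have hPV : P ⊆ V.powersetCard (k - 1) := by
    intro X hX
    obtain ⟨A, hA, rfl⟩ := mem_image.1 hX
    rw [hP₀, mem_filter] at hA
    have hA' := mem_powersetCard.1 (hF.1 hA.1)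
    refine mem_powersetCard.2 ⟨fun a ha => ?_, by rw [card_erase_of_mem hA.2.1, hA'.2]⟩
    rw [mem_erase] at ha
    exact (memV a).2 ⟨fun h => hA.2.2 (h ▸ ha.2), ha.1, hA'.1 ha.2⟩
  have hQV : Q ⊆ V.powersetCard (k - 1) := by
    intro X hX
    obtain ⟨A, hA, rfl⟩ := mem_image.1 hX
    rw [hQ₀, mem_filter] at hA
    have hA' := mem_powersetCard.1 (hF.1 hA.1)
    refine mem_powersetCard.2 ⟨fun a ha => ?_, by rw [card_erase_of_mem hA.2.1, hA'.2]⟩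
    rw [mem_erase] at ha
    exact (memV a).2 ⟨ha.1, fun h => hA.2.2 (h ▸ ha.2), hA'.1 ha.2⟩
  have hblocks : Blocks V (k - 1) Q (V.powersetCard (k - 1) \ P) := by
    intro X hX B hB hXB
    refine mem_sdiff.2 ⟨hX, fun hXP => ?_⟩
    obtain ⟨A, hA, rfl⟩ := mem_image.1 hXP
    obtain ⟨C, hC, rfl⟩ := mem_image.1 hB
    rw [hP₀, mem_filter] at hA
    rw [hQ₀, mem_filter] at hC
    obtain ⟨y, hy⟩ := hF.2 A hA.1 C hC.1
    rw [mem_inter] at hy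
    exact disjoint_left.1 hXB (mem_erase.2 ⟨fun h => hC.2.2 (h ▸ hy.2), hy.1⟩)
      (mem_erase.2 ⟨fun h => hA.2.2 (h ▸ hy.1), hy.2⟩)
  have hX : #(V.powersetCard (k - 1) \ P) + #P = (m + (k - 1)).choose (k - 1) := by
    rw [card_sdiff_add_card_eq_card hPV, card_powersetCard, hV]
  have hR : #(F.filter fun A => i ∈ A ∧ j ∈ A) ≤ (m + (k - 1)).choose (k - 2) := by
    rw [← hV, ← card_powersetCard]
    refine card_le_card_of_injOn (fun A => (A.erase i).erase j) ?_ ?_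
    · intro A hA
      rw [mem_coe, mem_filter] at hA
      have hA' := mem_powersetCard.1 (hF.1 hA.1)
      refine mem_powersetCard.2 ⟨fun a ha => ?_, ?_⟩
      · simp only [mem_erase] at ha
        exact (memV a).2 ⟨ha.1, ha.2.1, hA'.1 ha.2.2⟩
      · rw [card_erase_of_mem (mem_erase.2 ⟨hij.symm, hA.2.2⟩), card_erase_of_mem hA.2.1, hA'.2]
        omega
    · intro A hA B hB hAB
      rw [mem_coe, mem_filter] at hA hB
      have e : ∀ A : Finset ℕ, i ∈ A → j ∈ A → insert i (insert j ((A.erase i).erase j)) = A :=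
        fun A h1 h2 => by
          rw [insert_erase (mem_erase.2 ⟨hij.symm, h2⟩), insert_erase h1]
      rw [← e A hA.2.1 hA.2.2, ← e B hB.2.1 hB.2.2,
        show (A.erase i).erase j = (B.erase i).erase j from hAB]
  have hsplit : #F = #(F.filter fun A => i ∈ A ∧ j ∈ A) + #P₀ + #(avoiding i F) := by
    rw [← card_filter_add_card_filter_not (s := F) (fun A => i ∈ A),
      ← card_filter_add_card_filter_not (s := F.filter fun A => i ∈ A) (fun A => j ∈ A),
      filter_filter, filter_filter]
    rfl
  have hsplit' : #(avoiding i F) = #Q₀ + #(F.filter fun A => i ∉ A ∧ j ∉ A) := by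
    unfold avoiding
    rw [← card_filter_add_card_filter_not (s := F.filter fun A => i ∉ A) (fun A => j ∈ A),
      filter_filter, filter_filter]
    simp only [hQ₀, and_comm]
  have hc := three_mul_lt_choose hk hkm
  rw [show m + k + 1 - 3 = m + k - 2 by omega] at hi'
  -- Otherwise `Q` is larger than a star, so by cross-intersection `P` is at most a star,
  -- contradicting `#Q ≤ #P`.
  have hQle : #Q ≤ (m + (k - 1) - 1).choose (k - 1 - 1) := by
    by_contra! hlt
    have h1 := choose_le_card_of_choose_le_card hQV hblocks (by omega) (by omega)
      (by rw [hV]; exact hlt.le)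
    rw [hV] at h1
    have h2 := Nat.choose_succ_succ' (m + (k - 1) - 1) (k - 1 - 1)
    rw [show m + (k - 1) - 1 + 1 = m + (k - 1) by omega, show k - 1 - 1 + 1 = k - 1 by omega] at h2
    omega
  -- Now `p = q = k - 1`, so `j = 1` suffices. The lower bound on `#Q` holds because more than `3 *
  -- m` members avoid `i` and at most `m + 1` of them also avoid `j`.
  have hlex := card_add_le_of_two_mul_lt_card hV hQV hblocks (by omega) (by omega) (by omega) 1
    (by omega) (by omega) hQle (by omega)
  have hJ := le_card_familyJ hk hn
  have hbin := choose_add_three_mul_le hk hkm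
  have hpas := Nat.choose_succ_succ' (m + (k - 1)) (k - 2)
  rw [show m + (k - 1) + 1 = m + k by omega, show k - 2 + 1 = k - 1 by omega] at hpas
  rw [show m + k + 1 - 1 - k = m by omega, show m + k + 1 - 2 - k = m - 1 by omega,
    show m + k + 1 - 3 - k = m - 2 by omega, show m + k + 1 - 1 = m + k by omega] at hJ
  rw [show k - 1 - 1 = k - 2 by omega] at hlex
  omega

theorem IsIntersectingFamily.card_le_of_two_points' {n k i j : ℕ} {F : Finset (Finset ℕ)}
    (hF : IsIntersectingFamily n k F) (hk : 5 ≤ k) (hn : 2 * k < n) (hi : i ∈ ground n)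
    (hj : j ∈ ground n) (hij : i ≠ j) (hN : #(F.filter fun A => i ∉ A ∧ j ∉ A) ≤ n - k)
    (hi' : (n - 3).choose (k - 2) < #(avoiding i F))
    (hj' : (n - 3).choose (k - 2) < #(avoiding j F)) :
    #F ≤ #(familyJ n k 3) := by
  rcases le_total #(F.filter fun A => j ∈ A ∧ i ∉ A) #(F.filter fun A => i ∈ A ∧ j ∉ A) with h | h
  · exact hF.card_le_of_two_points hk hn hi hj hij hN hi' h
  · exact hF.card_le_of_two_points hk hn hj hi hij.symm (by simpa only [and_comm] using hN) hj' h

theorem IsIntersectingFamily.card_avoiding_le {n k x : ℕ} {F : Finset (Finset ℕ)}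
    (hF : IsIntersectingFamily n k F) (hk : 1 ≤ k) (hx : x ∈ ground n)
    {S : Finset ℕ} (hS : #S = k - 1) (hSA : ∀ A ∈ avoiding x F, S ⊆ A) :
    #(avoiding x F) ≤ n - k := by
  rcases (avoiding x F).eq_empty_or_nonempty with h | ⟨A, hA⟩
  · simp [h]
  have hSV : S ⊆ (ground n).erase x :=
    (hSA A hA).trans (mem_powersetCard.1 (hF.avoiding_subset x hA)).1
  have hc : #(slice S ∅ (((ground n).erase x).powersetCard k)) = n - k := by
    rw [card_slice_powersetCard hSV (empty_subset _) (disjoint_empty_right _) (by omega), hS,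
      card_erase_of_mem hx, card_ground, card_empty, show k - (k - 1) = 1 by omega,
      Nat.choose_one_right]
    omega
  rw [← hc]
  exact card_le_card fun B hB =>
    mem_slice.2 ⟨hF.avoiding_subset x hB, hSA B hB, disjoint_empty_right _⟩

/-! ### Shifting and shifted families. -/

section Shifting

/-- Replace `j` by `i` in `A`, unless this is impossible or the result is already in `F`. -/
def shiftSet (i j : ℕ) (F : Finset (Finset ℕ)) (A : Finset ℕ) : Finset ℕ :=
  if j ∈ A ∧ i ∉ A ∧ insert i (A.erase j) ∉ F then insert i (A.erase j) else A

/-- The shift of a family. -/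
def shift (i j : ℕ) (F : Finset (Finset ℕ)) : Finset (Finset ℕ) :=
  F.image (shiftSet i j F)

/-- The sum of the elements of the members of a family. -/
def weight (F : Finset (Finset ℕ)) : ℕ := ∑ A ∈ F, ∑ a ∈ A, a

/-- `F` is closed under replacing elements by smaller ones. -/
def IsShifted (F : Finset (Finset ℕ)) : Prop :=
  ∀ i j, 1 ≤ i → i < j → ∀ A ∈ F, j ∈ A → i ∉ A → insert i (A.erase j) ∈ F

theorem shiftSet_injOn (i j : ℕ) (F : Finset (Finset ℕ)) : Set.InjOn (shiftSet i j F) F := by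
  intro A hA B hB hAB
  unfold shiftSet at hAB
  split_ifs at hAB with h1 h2 h2
  · have e : ∀ A : Finset ℕ, j ∈ A → i ∉ A → insert j ((insert i (A.erase j)).erase i) = A :=
      fun A hj hi => by
        rw [erase_insert fun h => hi (mem_of_mem_erase h), insert_erase hj]
    rw [← e A h1.1 h1.2.1, ← e B h2.1 h2.2.1, hAB]
  · exact absurd (hAB ▸ hB) h1.2.2
  · exact absurd (hAB ▸ hA) h2.2.2
  · exact hAB

theorem card_shift (i j : ℕ) (F : Finset (Finset ℕ)) : #(shift i j F) = #F :=
  card_image_of_injOn (shiftSet_injOn i j F)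

theorem sum_insert_erase {i j : ℕ} {A : Finset ℕ} (hj : j ∈ A) (hi : i ∉ A) :
    ∑ a ∈ insert i (A.erase j), a + j = i + ∑ a ∈ A, a := by
  rw [sum_insert fun h => hi (mem_of_mem_erase h), add_assoc,
    sum_erase_add A (fun a => a) hj]

theorem weight_shift_lt {i j : ℕ} {F : Finset (Finset ℕ)} (hij : i < j) {A : Finset ℕ}
    (hA : A ∈ F) (hj : j ∈ A) (hi : i ∉ A) (h : insert i (A.erase j) ∉ F) :
    weight (shift i j F) < weight F := by
  unfold weight shift
  rw [sum_image (shiftSet_injOn i j F)]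
  refine sum_lt_sum (fun B _ => ?_) ⟨A, hA, ?_⟩
  · unfold shiftSet
    split_ifs with hB
    · have := sum_insert_erase hB.1 hB.2.1
      omega
    · rfl
  · have := sum_insert_erase hj hi
    rw [shiftSet, if_pos ⟨hj, hi, h⟩]
    omega

theorem isIntersectingFamily_shift {n k i j : ℕ} {F : Finset (Finset ℕ)}
    (hF : IsIntersectingFamily n k F) (hi : i ∈ ground n) :
    IsIntersectingFamily n k (shift i j F) := by
  have moved : ∀ A ∈ F, ∀ B ∈ F, (j ∈ A ∧ i ∉ A ∧ insert i (A.erase j) ∉ F) →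
      ¬ (j ∈ B ∧ i ∉ B ∧ insert i (B.erase j) ∉ F) → (insert i (A.erase j) ∩ B).Nonempty := by
    intro A hA B hB hA' hB'
    by_cases hiB : i ∈ B
    · exact ⟨i, mem_inter.2 ⟨mem_insert_self _ _, hiB⟩⟩
    by_cases hjB : j ∈ B
    -- `B` stays in place only because its shift is already in `F`; a common element of that shift
    -- and `A` is neither `i` nor `j`, so it also lies in `B` and in the shift of `A`.
    · have hBF : insert i (B.erase j) ∈ F := by
        by_contra h
        exact hB' ⟨hjB, hiB, h⟩
      obtain ⟨y, hy⟩ := hF.2 _ hBF A hA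
      simp only [mem_inter, mem_insert, mem_erase] at hy
      rcases hy with ⟨rfl | hy, hyA⟩
      · exact absurd hyA hA'.2.1
      · exact ⟨y, by simp [hy.1, hy.2, hyA]⟩
    · obtain ⟨y, hy⟩ := hF.2 A hA B hB
      rw [mem_inter] at hy
      exact ⟨y, mem_inter.2 ⟨mem_insert_of_mem (mem_erase.2 ⟨fun h => hjB (h ▸ hy.2), hy.1⟩),
        hy.2⟩⟩
  constructor
  · intro B hB
    obtain ⟨A, hA, rfl⟩ := mem_image.1 hB
    unfold shiftSet
    split_ifs with h
    · have hA' := mem_powersetCard.1 (hF.1 hA)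
      refine mem_powersetCard.2 ⟨insert_subset hi ((erase_subset _ _).trans hA'.1), ?_⟩
      rw [card_insert_of_notMem fun h' => h.2.1 (mem_of_mem_erase h'), card_erase_add_one h.1, hA'.2]
    · exact hF.1 hA
  · intro A' hA' B' hB'
    obtain ⟨A, hA, rfl⟩ := mem_image.1 hA'
    obtain ⟨B, hB, rfl⟩ := mem_image.1 hB'
    unfold shiftSet
    split_ifs with h1 h2 h2
    · exact ⟨i, mem_inter.2 ⟨mem_insert_self _ _, mem_insert_self _ _⟩⟩
    · exact moved A hA B hB h1 h2
    · rw [inter_comm]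
      exact moved B hB A hA h2 h1
    · exact hF.2 A hA B hB

theorem card_avoiding_le_card_avoiding_shift {i j x : ℕ} {F : Finset (Finset ℕ)} (hx : x ≠ i) :
    #(avoiding x F) ≤ #(avoiding x (shift i j F)) := by
  refine card_le_card_of_injOn (shiftSet i j F) ?_
    ((shiftSet_injOn i j F).mono (filter_subset _ _))
  intro A hA
  rw [mem_coe, mem_avoiding] at hA
  refine mem_avoiding.2 ⟨mem_image_of_mem _ hA.1, ?_⟩
  unfold shiftSet
  split_ifs
  · simp [hx, hA.2]
  · exact hA.2

theorem filter_subset_avoiding_shift (i j : ℕ) (F : Finset (Finset ℕ)) :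
    (F.filter fun A => i ∉ A ∧ j ∉ A) ⊆ avoiding i (shift i j F) := by
  intro A hA
  rw [mem_filter] at hA
  refine mem_avoiding.2 ⟨mem_image.2 ⟨A, hA.1, ?_⟩, hA.2.1⟩
  rw [shiftSet, if_neg fun h => hA.2.2 h.1]

/-- Otherwise some `c` below the least common element `b` lies in neither set. Replacing `b` by `c`
in `A` stays in `F` and shrinks the intersection, so induction gives an `m` for the new pair, which
is impossible in each of the ranges `m < c`, `b ≤ m` and `c ≤ m < b`. -/
theorem IsShifted.exists_lt_card_add_card {n k : ℕ} {F : Finset (Finset ℕ)} (hs : IsShifted F)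
    (hF : IsIntersectingFamily n k F) {A B : Finset ℕ} (hA : A ∈ F) (hB : B ∈ F) :
    ∃ m, m < #(A ∩ Icc 1 m) + #(B ∩ Icc 1 m) := by
  induction hd : #(A ∩ B) using Nat.strong_induction_on generalizing A with
  | _ d ih =>
    by_contra! hcon
    have hne := hF.2 A hA B hB
    obtain ⟨b, hb, hbmin⟩ := exists_min_image (A ∩ B) id hne
    have hbA := (mem_inter.1 hb).1
    have hbB := (mem_inter.1 hb).2
    have hb1 : 1 ≤ b := (mem_ground.1 ((mem_powersetCard.1 (hF.1 hA)).1 hbA)).1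
    have hui : ∀ m, #(A ∩ Icc 1 m) + #(B ∩ Icc 1 m) =
        #((A ∪ B) ∩ Icc 1 m) + #(A ∩ B ∩ Icc 1 m) := fun m => by
      rw [← card_union_add_card_inter, union_inter_distrib_right, ← inter_inter_distrib_right]
    have hpos : 0 < #(A ∩ B ∩ Icc 1 b) := card_pos.2 ⟨b, by simp [hbA, hbB, hb1]⟩
    have hlt : #((A ∪ B) ∩ Icc 1 b) < #(Icc 1 b) := by
      have h1 := hcon b
      have h2 := hui b
      rw [Nat.card_Icc]
      omega
    obtain ⟨c, hc, hcn⟩ := exists_mem_notMem_of_card_lt_card hlt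
    have hcAB : c ∉ A ∧ c ∉ B := by
      simp only [mem_inter, hc, and_true, mem_union, not_or] at hcn
      exact hcn
    rw [mem_Icc] at hc
    have hcb : c < b := lt_of_le_of_ne hc.2 fun h => hcAB.1 (h ▸ hbA)
    have hA' := hs c b hc.1 hcb A hA hbA hcAB.1
    have hI : insert c (A.erase b) ∩ B = (A ∩ B).erase b := by
      rw [insert_inter_of_notMem hcAB.2, erase_inter]
    obtain ⟨m, hm⟩ := ih _ (by
      rw [hI, card_erase_of_mem hb]
      have := card_pos.2 ⟨b, hb⟩
      omega) hA' rfl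
    have hm' := hcon m
    by_cases hmc : m < c
    · have : insert c (A.erase b) ∩ Icc 1 m ⊆ A ∩ Icc 1 m := by
        intro x hx
        simp only [mem_inter, mem_insert, mem_erase, mem_Icc] at hx ⊢
        rcases hx with ⟨rfl | hx, hx'⟩
        · omega
        · exact ⟨hx.2, hx'⟩
      have := card_le_card this
      omega
    by_cases hmb : b ≤ m
    · have : insert c (A.erase b) ∩ Icc 1 m ⊆ insert c ((A ∩ Icc 1 m).erase b) := by
        intro x hx
        simp only [mem_inter, mem_insert, mem_erase, mem_Icc] at hx ⊢
        tauto
      have h1 := card_le_card this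
      have h2 := card_insert_le c ((A ∩ Icc 1 m).erase b)
      have hbm : b ∈ A ∩ Icc 1 m := by simp [hbA, hb1, hmb]
      have h3 := card_erase_add_one hbm
      omega
    · have h1 : insert c (A.erase b) ∩ Icc 1 m ⊆ insert c (A ∩ Icc 1 m) := by
        intro x hx
        simp only [mem_inter, mem_insert, mem_erase, mem_Icc] at hx ⊢
        tauto
      have h2 := card_le_card h1
      have h3 := card_insert_le c (A ∩ Icc 1 m)
      have h4 : A ∩ B ∩ Icc 1 m = ∅ := by
        rw [eq_empty_iff_forall_notMem]
        intro x hx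
        rw [mem_inter, mem_Icc] at hx
        have := hbmin x hx.1
        simp only [id] at this
        omega
      have h5 := hui m
      rw [h4, card_empty] at h5
      have h6 : (A ∪ B) ∩ Icc 1 m ⊆ (Icc 1 m).erase c := by
        intro x hx
        rw [mem_inter, mem_union] at hx
        refine mem_erase.2 ⟨?_, hx.2⟩
        rintro rfl
        tauto
      have h7 := card_le_card h6
      rw [card_erase_of_mem (mem_Icc.2 ⟨hc.1, by omega⟩), Nat.card_Icc] at h7
      omega

/-- A ballot walk: the elements `r + 1, r + 2, …` are put into `U` or `W` one at a time. As soon as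
`W` outnumbers `U`, double counting ends the branch. A walk reaching `n` has a `W` too sparse to
contain a member of `F`. -/
theorem IsShifted.excess_nonpos {n k : ℕ} {F : Finset (Finset ℕ)} (hs : IsShifted F)
    (hF : IsIntersectingFamily n k F) (hk : 1 ≤ k) (hn : 2 * k < n) (d : ℕ) :
    ∀ (r : ℕ) (U W : Finset ℕ), r + d = n → 1 ≤ r → U ∪ W = Icc 2 r → Disjoint U W →
      (∀ m ≤ r, 2 * #(W ∩ Icc 1 m) ≤ m) → #W ≤ #U →
      excess (avoiding 1 F) (missing n k 1 F) U W ≤ 0 := by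
  have hV : ∀ r ≤ n, Icc 2 r ⊆ (ground n).erase 1 := fun r hr a ha => by
    rw [mem_Icc] at ha
    rw [mem_erase, mem_ground]
    omega
  induction d with
  | zero =>
    intro r U W hr _ hUW hd hW _
    refine excess_nonpos_of_slice_eq_empty fun B hB hWB hBU => ?_
    have hBV := mem_powersetCard.1 (hF.avoiding_subset 1 hB)
    have hBW : B ⊆ W := by
      intro x hx
      have h1 := hBV.1 hx
      rw [mem_erase, mem_ground] at h1
      have h2 : x ∈ U ∪ W := by
        rw [hUW, mem_Icc]
        omega
      exact (mem_union.1 h2).resolve_left fun h => disjoint_left.1 hBU hx h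
    -- Applied to `B` twice: `B` fills more than half of some `Icc 1 m`, whereas `W` never does.
    obtain ⟨m, hm⟩ := hs.exists_lt_card_add_card hF (mem_avoiding.1 hB).1 (mem_avoiding.1 hB).1
    have h1 : #(B ∩ Icc 1 m) ≤ #(W ∩ Icc 1 (min m r)) := by
      refine card_le_card fun x hx => ?_
      rw [mem_inter, mem_Icc] at hx ⊢
      have h2 : x ∈ U ∪ W := mem_union_right _ (hBW hx.1)
      rw [hUW, mem_Icc] at h2
      exact ⟨hBW hx.1, hx.2.1, le_min hx.2.2 h2.2⟩
    have h2 := hW (min m r) (min_le_right _ _)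
    have h3 := min_le_left m r
    omega
  | succ d ih =>
    intro r U W hr hr1 hUW hd hW hle
    have hnew : r + 1 ∉ U ∪ W := by
      rw [hUW, mem_Icc]
      omega
    rw [mem_union, not_or] at hnew
    have hcard : #U + #W = r - 1 := by
      rw [← card_union_of_disjoint hd, hUW, Nat.card_Icc]
      omega
    have hIcc : insert (r + 1) (Icc 2 r) = Icc 2 (r + 1) := by
      ext a
      simp only [mem_insert, mem_Icc]
      omega
    rw [excess_eq_add _ _ U W (r + 1)]
    have h1 := ih (r + 1) (insert (r + 1) U) W (by omega) (by omega)
      (by rw [insert_union, hUW, hIcc]) (disjoint_insert_left.2 ⟨hnew.2, hd⟩) (fun m hm => by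
        obtain h | h := (by omega : m ≤ r ∨ m = r + 1)
        · exact hW m h
        · have := card_le_card (inter_subset_left (s₁ := W) (s₂ := Icc 1 m))
          omega) (by rw [card_insert_of_notMem hnew.1]; omega)
    have h2 : excess (avoiding 1 F) (missing n k 1 F) U (insert (r + 1) W) ≤ 0 := by
      by_cases hlt : #W + 1 ≤ #U
      · refine ih (r + 1) U (insert (r + 1) W) (by omega) (by omega)
          (by rw [union_insert, hUW, hIcc]) (disjoint_insert_right.2 ⟨hnew.1, hd⟩) (fun m hm => ?_)
          (by rw [card_insert_of_notMem hnew.2]; omega)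
        obtain h | h := (by omega : m ≤ r ∨ m = r + 1)
        · rw [insert_inter_of_notMem (by rw [mem_Icc]; omega)]
          exact hW m h
        · have := card_le_card (inter_subset_left (s₁ := insert (r + 1) W) (s₂ := Icc 1 m))
          rw [card_insert_of_notMem hnew.2] at this
          omega
      · refine LargeIntersecting.excess_nonpos (hF.avoiding_subset 1) (hF.blocks 1)
          ((subset_union_left.trans hUW.subset).trans (hV r (by omega))) ?_ ?_ ?_
        · refine insert_subset (hV (r + 1) (by omega) (by rw [mem_Icc]; omega))
            ((subset_union_right.trans hUW.subset).trans (hV r (by omega)))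
        · rw [card_erase_of_mem (mem_ground.2 (by omega)), card_ground]
          omega
        · rw [card_insert_of_notMem hnew.2]
          omega
    linarith

/-- Take a member of least sum among those that avoid 1 and do not contain `Icc 2 k`. By minimality,
lowering any of its elements to a free value at least 2 must complete `Icc 2 k`; this determines the
set. -/
theorem IsShifted.mem_of_not_isStructured {n k : ℕ} {F : Finset (Finset ℕ)} (hs : IsShifted F)
    (hF : IsIntersectingFamily n k F) (hk : 5 ≤ k) (hn : 2 * k < n) (hns : ¬ IsStructured n k F) :
    insert (k + 1) (insert (k + 2) (Icc 2 (k - 1))) ∈ F := by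
  have hne : (F.filter fun B => 1 ∉ B ∧ ¬ Icc 2 k ⊆ B).Nonempty := by
    by_contra h
    refine hns ⟨1, mem_ground.2 (by omega), Icc 2 k, by rw [Nat.card_Icc]; omega, ?_⟩
    intro A hA
    rw [mem_avoiding] at hA
    by_contra h'
    exact h ⟨A, mem_filter.2 ⟨hA.1, hA.2, h'⟩⟩
  obtain ⟨B, hB, hmin⟩ := exists_min_image _ (fun B : Finset ℕ => ∑ a ∈ B, a) hne
  rw [mem_filter] at hB
  obtain ⟨hBF, hB1, hBk⟩ := hB
  have hBc := mem_powersetCard.1 (hF.1 hBF)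
  have hpos : ∀ a ∈ B, 2 ≤ a := fun a ha => by
    have h1 := mem_ground.1 (hBc.1 ha)
    have h2 : a ≠ 1 := fun h => hB1 (h ▸ ha)
    omega
  have hstep : ∀ i j, 2 ≤ i → i < j → j ∈ B → i ∉ B → Icc 2 k ⊆ insert i (B.erase j) := by
    intro i j hi hij hj hiB
    by_contra hcon
    have h1 := hmin (insert i (B.erase j)) (mem_filter.2
      ⟨hs i j (by omega) hij B hBF hj hiB, by simp [hB1]; omega, hcon⟩)
    have h2 := sum_insert_erase hj hiB
    omega
  have hlarge : ∀ D : Finset ℕ, #D < k → ∃ j ∈ B, j ∉ D := fun D hD =>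
    exists_mem_notMem_of_card_lt_card (by rw [hBc.2]; exact hD)
  obtain ⟨s, hs2, hsB⟩ := not_subset.1 hBk
  rw [mem_Icc] at hs2
  obtain ⟨j, hj, hjk⟩ := hlarge (Icc 2 k) (by rw [Nat.card_Icc]; omega)
  have hj2 := hpos j hj
  rw [mem_Icc] at hjk
  have hsub := hstep s j hs2.1 (by omega) hj hsB
  -- If another element `s` were missing, `k` would be present, and moving `k` to `s` would lose `k`
  -- instead of completing `Icc 2 k`.
  have hsk : s = k := by
    by_contra hsk
    have hkB : k ∈ B := by
      have := hsub (mem_Icc.2 ⟨by omega, le_rfl⟩)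
      rw [mem_insert, mem_erase] at this
      rcases this with h | h
      · omega
      · exact h.2
    have := hstep s k hs2.1 (by omega) hkB hsB (mem_Icc.2 ⟨by omega, le_rfl⟩)
    rw [mem_insert, mem_erase] at this
    omega
  subst hsk
  have hTB : Icc 2 (s - 1) ⊆ B := by
    intro x hx
    rw [mem_Icc] at hx
    have := hsub (mem_Icc.2 ⟨hx.1, by omega⟩)
    rw [mem_insert, mem_erase] at this
    rcases this with h | h
    · omega
    · exact h.2
  have hno : ∀ i j, s < i → i < j → j ∈ B → i ∈ B := by
    intro i j hi hij hj'
    by_contra hiB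
    have := hstep i j (by omega) hij hj' hiB (mem_Icc.2 ⟨by omega, le_rfl⟩)
    rw [mem_insert, mem_erase] at this
    rcases this with h | h
    · omega
    · exact hsB h.2
  have hs1 : s + 1 ∈ B := by
    obtain h | h := (by omega : j = s + 1 ∨ s + 1 < j)
    · exact h ▸ hj
    · exact hno (s + 1) j (by omega) h hj
  have hs2' : s + 2 ∈ B := by
    obtain ⟨l, hl, hl'⟩ := hlarge (insert (s + 1) (Icc 2 (s - 1))) (by
      have := card_insert_le (s + 1) (Icc 2 (s - 1))
      rw [Nat.card_Icc] at this
      omega)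
    have hl2 := hpos l hl
    rw [mem_insert, mem_Icc, not_or] at hl'
    have hls : l ≠ s := fun h => hsB (h ▸ hl)
    obtain h | h := (by omega : l = s + 2 ∨ s + 2 < l)
    · exact h ▸ hl
    · exact hno (s + 2) l (by omega) h hl
  have hsubset : insert (s + 1) (insert (s + 2) (Icc 2 (s - 1))) ⊆ B :=
    insert_subset hs1 (insert_subset hs2' hTB)
  rwa [eq_of_subset_of_card_le hsubset]
  rw [card_insert_of_notMem (by rw [mem_insert, mem_Icc]; omega),
    card_insert_of_notMem (by rw [mem_Icc]; omega), Nat.card_Icc, hBc.2]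
  omega

theorem IsShifted.card_le {n k : ℕ} {F : Finset (Finset ℕ)} (hs : IsShifted F)
    (hF : IsIntersectingFamily n k F) (hk : 5 ≤ k) (hn : 2 * k < n) (hns : ¬ IsStructured n k F) :
    #F ≤ #(familyJ n k 3) := by
  have h1n : 1 ∈ ground n := mem_ground.2 (by omega)
  refine hF.card_le_card_familyJ_of_missing hk hn h1n ?_
  have hV : #((ground n).erase 1) = n - 1 - k + k := by
    rw [card_erase_of_mem h1n, card_ground]; omega
  have hbc := hs.mem_of_not_isStructured hF hk hn hns
  have hT : ∀ a, a ∈ Icc 2 (k - 1) ↔ 2 ≤ a ∧ a ≤ k - 1 := fun a => mem_Icc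
  have hac : insert k (insert (k + 2) (Icc 2 (k - 1))) ∈ F := by
    have := hs k (k + 1) (by omega) (by omega) _ hbc (by simp) (by simp; omega)
    rwa [erase_insert (by simp)] at this
  have hab : insert k (insert (k + 1) (Icc 2 (k - 1))) ∈ F := by
    rw [insert_comm] at hbc
    have := hs k (k + 2) (by omega) (by omega) _ hbc (by simp) (by simp; omega)
    rwa [erase_insert (by simp; omega)] at this
  have hchain : excess (avoiding 1 F) (missing n k 1 F) ∅ ∅ ≤
      excess (avoiding 1 F) (missing n k 1 F) ∅ (Icc 2 (k - 1)) := by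
    have e1 := excess_eq_add (avoiding 1 F) (missing n k 1 F) ∅ ∅ 2
    have e2 := excess_eq_add (avoiding 1 F) (missing n k 1 F) ∅ {2} 3
    rw [insert_empty_eq] at e1 e2
    -- Double counting with `#U = 1` needs `2 ≤ #W`, so the branches with `W = ∅` and `W = {2}` are
    -- settled by the ballot walk instead.
    have l1 := hs.excess_nonpos hF (by omega) hn (n - 2) 2 {2} ∅ (by omega) (by omega) (by simp)
      (disjoint_empty_right _) (by simp) (by simp)
    have l2 := hs.excess_nonpos hF (by omega) hn (n - 3) 3 {3} {2} (by omega) (by omega)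
      (by decide) (by decide) (fun m hm => by interval_cases m <;> decide) (by simp)
    have l3 := excess_le_excess_union (ℬ := avoiding 1 F) (𝒳 := missing n k 1 F) (U := ∅)
      (W := {3, 2}) (Icc 2 (k - 1)) fun i hi W' hW hW' _ => by
        have hsub : ∀ a, 2 ≤ a → a ≤ k - 1 → a ∈ (ground n).erase 1 := fun a h1 h2 => by
          rw [mem_erase, mem_ground]
          omega
        rw [hT] at hi
        refine LargeIntersecting.excess_nonpos (hF.avoiding_subset 1) (hF.blocks 1)
          (by simpa using hsub i hi.1 hi.2) (fun a ha => ?_) (by omega) ?_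
        · have := hW' ha
          simp only [mem_union, mem_insert, mem_singleton, hT] at this
          exact hsub a (by omega) (by omega)
        · have := card_le_card hW
          rw [card_pair (by decide)] at this
          rw [insert_empty_eq, card_singleton]
          omega
    rw [union_eq_right.2 (fun a ha => by
      simp only [mem_insert, mem_singleton] at ha
      rw [hT]
      omega)] at l3
    linarith
  have mem : ∀ a b, 2 ≤ a → 2 ≤ b → insert a (insert b (Icc 2 (k - 1))) ∈ F →
      insert a (insert b (Icc 2 (k - 1))) ∈ avoiding 1 F := fun a b ha hb h =>
    mem_avoiding.2 ⟨h, by simp; omega⟩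
  have := card_add_le_of_triangle (hF.avoiding_subset 1) (hF.blocks 1) hV (by omega) hk hchain
    (by rw [Nat.card_Icc]; omega) (a := k) (b := k + 1) (c := k + 2) (by rw [hT]; omega)
    (by rw [hT]; omega) (by rw [hT]; omega) (by omega) (by omega) (by omega)
    (mem _ _ (by omega) (by omega) hab) (mem _ _ (by omega) (by omega) hac)
    (mem _ _ (by omega) (by omega) hbc)
  have := choose_add_le_of_triangle (k := k) (m := n - 1 - k) hk (by omega)
  omega

end Shifting

/-! ### Induction on the weight, and embedding structured families. -/

/-- Intersecting families larger than `familyJ n k 3` are structured. -/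
theorem IsIntersectingFamily.card_le_card_familyJ {n k : ℕ} (hk : 5 ≤ k) (hn : 2 * k < n)
    {F : Finset (Finset ℕ)} (hF : IsIntersectingFamily n k F) (hns : ¬ IsStructured n k F) :
    #F ≤ #(familyJ n k 3) := by
  induction hw : weight F using Nat.strong_induction_on generalizing F with
  | _ w ih =>
    by_cases hs : IsShifted F
    · exact hs.card_le hF hk hn hns
    by_cases hdiv : ∃ y ∈ ground n, #(avoiding y F) ≤ (n - 3).choose (k - 2)
    · obtain ⟨y, hy, hle⟩ := hdiv
      exact hF.card_le_of_card_avoiding_le hk hn hy hns hle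
    push Not at hdiv
    unfold IsShifted at hs
    push Not at hs
    obtain ⟨i, j, hi1, hij, A, hA, hjA, hiA, hAF⟩ := hs
    have hj : j ∈ ground n := (mem_powersetCard.1 (hF.1 hA)).1 hjA
    have hi : i ∈ ground n := mem_ground.2 ⟨hi1, by have := (mem_ground.1 hj).2; omega⟩
    have hF' := isIntersectingFamily_shift (j := j) hF hi
    by_cases hst : IsStructured n k (shift i j F)
    swap
    · rw [← card_shift i j F]
      exact ih _ (hw ▸ weight_shift_lt hij hA hjA hiA hAF) hF' hst rfl
    obtain ⟨x, hx, S, hS, hSA⟩ := hst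
    have hle := hF'.card_avoiding_le (by omega) hx hS hSA
    by_cases hxi : x = i
    -- Members avoiding both `i` and `j` are not moved, so at most `n - k` of them exist.
    · subst hxi
      exact hF.card_le_of_two_points' hk hn hx hj hij.ne
        ((card_le_card (filter_subset_avoiding_shift x j F)).trans hle) (hdiv x hx) (hdiv j hj)
    -- Shifting introduces only the element `i`, so already in `F` at most `n - k` members avoid
    -- `x`, against the choice of the case.
    · have h1 := card_avoiding_le_card_avoiding_shift (j := j) (F := F) hxi
      have h2 := hdiv x hx
      have h3 := three_mul_lt_choose (k := k) (m := n - 1 - k) hk (by omega)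
      rw [show n - 1 - k + k - 2 = n - 3 by omega] at h3
      omega

theorem exists_isCopyOfE {n k l x : ℕ} {F : Finset (Finset ℕ)} (hF : IsIntersectingFamily n k F)
    (hl : #(avoiding x F) = l)
    (hc : 2 ≤ l → #(commonIntersection n (avoiding x F)) = k - 1) :
    ∃ E, IsCopyOfE n k l x E ∧ F ⊆ E := by
  have hfin : {G : Finset (Finset ℕ) | IsIntersectingFamily n k G ∧ #(avoiding x G) = l ∧
      (2 ≤ l → #(commonIntersection n (avoiding x G)) = k - 1)}.Finite :=
    (finite_toSet ((ground n).powersetCard k).powerset).subset fun G hG => by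
      simpa using hG.1.1
  obtain ⟨E, hFE, hE⟩ := hfin.exists_le_maximal ⟨hF, hl, hc⟩
  exact ⟨E, hE, hFE⟩

theorem card_commonIntersection {n k : ℕ} {M : Finset (Finset ℕ)}
    (hM : M ⊆ (ground n).powersetCard k) {S : Finset ℕ} (hS : #S = k - 1)
    (hSA : ∀ A ∈ M, S ⊆ A) (h2 : 2 ≤ #M) : #(commonIntersection n M) = k - 1 := by
  obtain ⟨A, hA, B, hB, hAB⟩ := one_lt_card.1 h2
  have hAc := mem_powersetCard.1 (hM hA)
  have hBc := mem_powersetCard.1 (hM hB)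
  refine le_antisymm ?_ ?_
  · have hlt : #(A ∩ B) < #A := by
      refine card_lt_card (ssubset_of_subset_of_ne inter_subset_left fun h => hAB ?_)
      exact eq_of_subset_of_card_le (inter_eq_left.1 h) (by rw [hAc.2, hBc.2])
    have hsub : commonIntersection n M ⊆ A ∩ B := fun a ha => by
      have := (mem_filter.1 ha).2
      exact mem_inter.2 ⟨this A hA, this B hB⟩
    have := card_le_card hsub
    omega
  · rw [← hS]
    exact card_le_card fun a ha => mem_filter.2 ⟨hAc.1 (hSA A hA ha), fun C hC => hSA C hC ha⟩

/-- With at most `k - 1` members avoiding `x`, extend `F` to a maximal family. With at least `k`,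
every member of `F` meets `S`, so all `n - k` supersets of `S` of size `k` avoiding `x` can be added
first; hence no `l` strictly between `k - 1` and `n - k` is needed. -/
theorem IsStructured.exists_isCopyOfE {n k : ℕ} {F : Finset (Finset ℕ)} (hk : 5 ≤ k)
    (hn : 2 * k < n) (hF : IsIntersectingFamily n k F) (hst : IsStructured n k F) :
    ∃ l : ℕ, (l ≤ k - 1 ∨ l = n - k) ∧
      ∃ x ∈ ground n, ∃ E : Finset (Finset ℕ), IsCopyOfE n k l x E ∧ F ⊆ E := by
  obtain ⟨x, hx, S, hS, hSA⟩ := hst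
  have hsub : ∀ G, IsIntersectingFamily n k G → avoiding x G ⊆ (ground n).powersetCard k :=
    fun G hG => (filter_subset _ _).trans hG.1
  by_cases hl : #(avoiding x F) ≤ k - 1
  · exact ⟨_, Or.inl hl, x, hx, LargeIntersecting.exists_isCopyOfE hF rfl
      fun h => card_commonIntersection (hsub F hF) hS hSA h⟩
  refine ⟨n - k, Or.inr rfl, x, hx, ?_⟩
  obtain ⟨A₀, hA₀⟩ : (avoiding x F).Nonempty := card_pos.1 (by omega)
  have hSV : S ⊆ (ground n).erase x :=
    (hSA A₀ hA₀).trans (mem_powersetCard.1 (hF.avoiding_subset x hA₀)).1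
  let D := slice S ∅ (((ground n).erase x).powersetCard k)
  have hDc : #D = n - k := by
    rw [card_slice_powersetCard hSV (empty_subset _) (disjoint_empty_right _) (by omega), hS,
      card_erase_of_mem hx, card_ground, card_empty, show k - (k - 1) = 1 by omega,
      Nat.choose_one_right]
    omega
  have hD : ∀ A ∈ D, A ∈ (ground n).powersetCard k ∧ x ∉ A ∧ S ⊆ A := by
    intro A hA
    rw [mem_slice] at hA
    have := mem_powersetCard.1 hA.1
    exact ⟨mem_powersetCard.2 ⟨this.1.trans (erase_subset _ _), this.2⟩,
      fun h => by simpa using this.1 h, hA.2.1⟩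
  have havD : avoiding x F ⊆ D := fun A hA =>
    mem_slice.2 ⟨hF.avoiding_subset x hA, hSA A hA, disjoint_empty_right _⟩
  have hSne : S.Nonempty := card_pos.1 (by omega)
  have hmeet : ∀ A ∈ F, (A ∩ S).Nonempty := by
    intro A hA
    by_cases hxA : x ∈ A
    swap
    · have := hSA A (mem_avoiding.2 ⟨hA, hxA⟩)
      rwa [inter_eq_right.2 this]
    by_contra hne
    rw [not_nonempty_iff_eq_empty, ← disjoint_iff_inter_eq_empty] at hne
    -- If `A` contains `x` and misses `S`, each member avoiding `x` meets `A.erase x` exactly in its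
    -- one element outside `S`, so there are at most `k - 1` such members.
    have hdisj : ((avoiding x F : Finset (Finset ℕ)) : Set (Finset ℕ)).InjOn
        fun B => B ∩ A.erase x := by
      intro B hB C hC hBC
      have key : ∀ B ∈ avoiding x F, B = S ∪ (B ∩ A.erase x) := by
        intro B hB
        have hBm := mem_avoiding.1 hB
        have hBc := (mem_powersetCard.1 (hF.1 hBm.1)).2
        have hSB := hSA B hB
        obtain ⟨y, hy⟩ := hF.2 A hA B hBm.1
        rw [mem_inter] at hy
        have hyx : y ≠ x := fun h => hBm.2 (h ▸ hy.2)
        have hyS : y ∉ S := fun h => disjoint_left.1 hne hy.1 h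
        refine (eq_of_subset_of_card_le (union_subset hSB inter_subset_left) ?_).symm
        have : insert y S ⊆ S ∪ (B ∩ A.erase x) := insert_subset
          (mem_union_right _ (mem_inter.2 ⟨hy.2, mem_erase.2 ⟨hyx, hy.1⟩⟩)) subset_union_left
        have := card_le_card this
        rw [card_insert_of_notMem hyS] at this
        omega
      rw [key B hB, key C hC, show B ∩ A.erase x = C ∩ A.erase x from hBC]
    have hle : #(avoiding x F) ≤ #((A.erase x).powersetCard 1) := by
      refine card_le_card_of_injOn _ ?_ hdisj
      intro B hB
      have hBm := mem_avoiding.1 hB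
      have hBc := (mem_powersetCard.1 (hF.1 hBm.1)).2
      refine mem_powersetCard.2 ⟨inter_subset_right, ?_⟩
      have hSB := hSA B hB
      have h1 : Disjoint S (B ∩ A.erase x) := disjoint_left.2 fun a ha hb =>
        disjoint_left.1 hne (mem_of_mem_erase (mem_inter.1 hb).2) ha
      have h2 := card_le_card (union_subset hSB (inter_subset_left (s₁ := B) (s₂ := A.erase x)))
      rw [card_union_of_disjoint h1] at h2
      have h3 : 0 < #(B ∩ A.erase x) := by
        obtain ⟨y, hy⟩ := hF.2 A hA B hBm.1
        rw [mem_inter] at hy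
        exact card_pos.2 ⟨y, mem_inter.2 ⟨hy.2, mem_erase.2 ⟨fun h => hBm.2 (h ▸ hy.2), hy.1⟩⟩⟩
      change #(B ∩ A.erase x) = 1
      omega
    rw [card_powersetCard, Nat.choose_one_right, card_erase_of_mem hxA,
      (mem_powersetCard.1 (hF.1 hA)).2] at hle
    exact hl hle
  have hFD : IsIntersectingFamily n k (F ∪ D) := by
    have hmeet' : ∀ A ∈ F ∪ D, ∀ B ∈ D, (A ∩ B).Nonempty := by
      intro A hA B hB
      rcases mem_union.1 hA with hA | hA
      · exact (hmeet A hA).mono (inter_subset_inter_left (hD B hB).2.2)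
      · exact hSne.mono (subset_inter (hD A hA).2.2 (hD B hB).2.2)
    refine ⟨union_subset hF.1 fun A hA => (hD A hA).1, fun A hA B hB => ?_⟩
    rcases mem_union.1 hB with hB' | hB'
    · rcases mem_union.1 hA with hA' | hA'
      · exact hF.2 A hA' B hB'
      · rw [inter_comm]
        exact hmeet' B hB A hA'
    · exact hmeet' A hA B hB'
  have hav : avoiding x (F ∪ D) = D := by
    ext A
    rw [mem_avoiding, mem_union]
    constructor
    · rintro ⟨hA | hA, hxA⟩
      · exact havD (mem_avoiding.2 ⟨hA, hxA⟩)
      · exact hA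
    · exact fun hA => ⟨Or.inr hA, (hD A hA).2.1⟩
  obtain ⟨E, hE, hFE⟩ := LargeIntersecting.exists_isCopyOfE hFD (x := x) (l := n - k)
    (by rw [hav, hDc]) fun h => by
      rw [hav]
      exact card_commonIntersection (fun A hA => (hD A hA).1) hS (fun A hA => (hD A hA).2.2)
        (by omega)
  exact ⟨E, hE, subset_union_left.trans hFE⟩

end LargeIntersecting

theorem mainTheorem8 (n k : ℕ) (hk : 10 ≤ 2 * k) (hn : 2 * k < n)
    (F : Finset (Finset ℕ)) (hF : LargeIntersecting.IsIntersectingFamily n k F)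
    (hcard : (LargeIntersecting.familyJ n k 3).card < F.card) :
    ∃ l : ℕ, (l ≤ k - 1 ∨ l = n - k) ∧
      ∃ x ∈ LargeIntersecting.ground n, ∃ E : Finset (Finset ℕ),
        LargeIntersecting.IsCopyOfE n k l x E ∧ F ⊆ E := by
  refine LargeIntersecting.IsStructured.exists_isCopyOfE (by omega) hn hF ?_
  by_contra hns
  exact absurd (hF.card_le_card_familyJ (by omega) hn hns) (by omega)
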